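/- Let $F$ be a two-dimensional non-archimedean local field: $F$ is complete with respect to a discrete valuation $\nu:F^\times\to\mathbb{Z}$, with ring of integers $\mathcal{O}_F$ and residue field $\bar F$ a non-archimedean local field; write $x\mapsto\bar x$ for the residue map. Let $t_1,t_2$ be local parameters, i.e. $\nu(t_2)=1$, $\nu(t_1)=0$, and $\pi=\bar t_1$ is a prime of $\bar F$. Put $\eta(x)=\overline{x\,t_2^{-\nu(x)}}$ for $x\in F^\times$. Let $w$ be the normalised valuation, $q$ the cardinality of the residue field and $|\cdot|=q^{-w(\cdot)}$ the normalised absolute value of $\bar F$. Fix a Haar measure $dx$ on $\bar F$, let $d^\times x=|x|^{-1}dx$ on $\bar F^\times$, and let $\mu$ be the measure $d^\times x$. **Integration.** For a Haar integrable $g:\bar F\times\bar F\to\mathbb{C}$, $a\in F^2$ and $\gamma\in\mathbb{Z}^2$, the lift $g^{a,\gamma}$ is the function on $F\times F$ equal to $g\big(\overline{(x_1-a_1)t_2^{-\gamma_1}},\overline{(x_2-a_2)t_2^{-\gamma_2}}\big)$ on $\prod_i(a_i+t_2^{\gamma_i}\mathcal{O}_F)$ and to $0$ elsewhere. The integrable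 functions on $F\times F$ form the $\mathbb{C}(X)$-span of all such lifts, and the integral is the $\mathbb{C}(X)$-linear functional with $\int^{F^2}g^{a,\gamma}=\big(\int\!\!\int g\big)X^{\gamma_1+\gamma_2}$. For $x\in F^\times$ put $|x|=|\eta(x)|X^{\nu(x)}\in\mathbb{C}(X)$. A function $\phi:F^\times\times F^\times\to\mathbb{C}(X)$ is integrable if $\phi(x,y)|x|^{-1}|y|^{-1}$ extends to an integrable function on $F\times F$; its integral is that of the extension. **Zeta integrals.** Let $K_2^t(F)=K_2(F)/\bigcap_{l\ge1}lK_2(F)$ be the topological Milnor $K$-group and $\partial:K_2^t(F)\to\bar F^\times$ the border map (tame symbol), normalised by $\partial\{u,t_2\}=\bar u$ for $u\in\mathcal{O}_F^\times$; put $|\xi|=|\partial\xi|$. Let $T=\mathcal{O}_F^\times\times\mathcal{O}_F^\times$ and let $\mathfrak{t}:T\to K_2^t(F)$ be the homomorphism $$\mathfrak{t}(t_1^iu,t_1^jv)=(i+j)\{t_1,t_2\}+\{u,t_2\}+\{t_1,v\}\qquad(i,j\in\mathbb{Z},\ w(\bar u)=w(\bar v)=0),$$ so that $|\mathfrak{t}(x,y)|=|x||y|$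 on $T$. For a $\mathbb{C}(X)$-valued function $f$, a quasi-character $\chi$ of $K_2^t(F)$ and $s\in\mathbb{C}$ put $$\zeta(f,\chi,s)=\int^{F^\times\times F^\times}f(x,y)\,\chi(\mathfrak{t}(x,y))\,|\mathfrak{t}(x,y)|^s\,\mathrm{char}_T(x,y)\,d^\times x\,d^\times y,$$ which is said to be well-defined if the integrand is integrable and its integral is unique. Let $\rho_2(t_1^{i_1}t_2^{i_2}u,t_1^{j_1}t_2^{j_2}v)=\overline{t_1^{\min(i_1,j_1)}t_2^{\min(i_2,j_2)}u}$ for pairs of nonzero elements of $\mathcal{O}_F$, where $u,v\in\mathcal{O}_F^\times$ and $w(\bar u)=w(\bar v)=0$. On $\bar F$ put $\zeta_{\bar F}(g,\omega,s)=\int_{\bar F^\times}g(x)\omega(x)|x|^s\,d^\times x$. For a quasi-character $\omega$ of $\bar F^\times$ let $L(\omega,s)=(1-\omega(\pi)q^{-s})^{-1}$ if $\omega$ is trivial on $\mathcal{O}_{\bar F}^\times$, and $L(\omega,s)=1$ otherwise. **Proposition.** Let $\omega$ be a quasi-character of $\bar F^\times$, written $\omega=\omega_0|\cdot|^c$ with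 $c\in\mathbb{C}$ and $\omega_0$ a quasi-character of $\bar F^\times$ with $\omega_0(\pi)=1$. Let $s\in\mathbb{C}$ with $\mathrm{Re}(s+c)>0$, and let $g:\bar F\to\mathbb{C}$ be such that $g\,\omega^2|\cdot|^{2s}$ is integrable on $\bar F^\times$ with respect to $d^\times x$. Put $\chi=\omega\circ\partial$. Then $\zeta(g\circ\rho_2,\chi,s)$ is well-defined, $\zeta_{\bar F}(g,\omega,2s+c)$ converges absolutely, and $$\zeta(g\circ\rho_2,\chi,s)=\mu(\mathcal{O}_{\bar F}^\times)\,\frac{1+q^{-s-c}}{1-q^{-s-c}}\,\zeta_{\bar F}(g,\omega,2s+c).$$ **Corollary.** Let $\omega$ be a quasi-character of $\bar F^\times$, $\chi=\omega\circ\partial$, and $g$ a Schwartz–Bruhat function on $\bar F$. Then for $\mathrm{Re}(s)$ sufficiently large $\zeta(g\circ\rho_2,\chi,s)$ is well-defined, and the function $$\frac{\zeta(g\circ\rho_2,\chi,s)}{L(\omega,s)\,(1-\omega(\pi)q^{-s})^{-1}},$$ initially defined for $\mathrm{Re}(s)$ sufficiently large, is complex-valued and has an analytic continuation to an entire function of $s$.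 -/

import Mathlib

open MeasureTheory ValuativeRel
open scoped WithZero TensorProduct

noncomputable section

namespace TwoDimZeta

/-! ## One-dimensional non-archimedean local fields -/

section OneDim

variable {K : Type*} [Field K] [ValuativeRel K] [TopologicalSpace K]
  [IsNonarchimedeanLocalField K]

/-- The normalised discrete valuation `w : Kˣ → ℤ` of a local field (with junk value `w 0 = 0`). -/
def ord (x : K) : ℤ :=
  -WithZero.log (IsNonarchimedeanLocalField.valueGroupWithZeroIsoInt K (valuation K x))

variable (K) in
/-- The cardinality `q` of the (finite) residue field of a local field. -/
def resCard : ℕ := Nat.card (IsLocalRing.ResidueField (valuation K).integer)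

open Classical in
/-- The normalised absolute value `|x| = q ^ (-w x)`, `|0| = 0`. -/
def nabs (x : K) : ℝ := if x = 0 then 0 else (resCard K : ℝ) ^ (-ord x)

/-- The multiplicative Haar measure `d×x = |x|⁻¹ dx` on `Kˣ` attached to a Haar measure `μ = dx`
on `K`. -/
def mulHaar [MeasurableSpace K] (μ : Measure K) : Measure Kˣ :=
  (μ.withDensity fun x => ENNReal.ofReal (nabs x)⁻¹).comap Units.val

/-- The integrand `g(x) ω(x) |x|^s` of the local zeta integral on `K`. -/
def zetaIntegrandK (g : K → ℂ) (ω : Kˣ →ₜ* ℂˣ) (s : ℂ) (x : Kˣ) : ℂ :=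
  g x * (ω x : ℂ) * (nabs (x : K) : ℂ) ^ s

/-- The local zeta integral `ζ_K(g, ω, s) = ∫ g(x) ω(x) |x|^s d×x` over `Kˣ`. -/
def zetaK [MeasurableSpace K] (μ : Measure K) (g : K → ℂ) (ω : Kˣ →ₜ* ℂˣ) (s : ℂ) : ℂ :=
  ∫ x, zetaIntegrandK g ω s x ∂(mulHaar μ)

open Classical in
/-- The local `L`-function of a quasi-character `ω` of `Kˣ`, computed with a prime `π`:
`(1 - ω(π) q^(-s))⁻¹` if `ω` is unramified (trivial on the units of the ring of integers),
and `1` if `ω` is ramified. -/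
def localL (π : Kˣ) (ω : Kˣ →ₜ* ℂˣ) (s : ℂ) : ℂ :=
  if ∀ u : Kˣ, ord (u : K) = 0 → ω u = 1 then (1 - (ω π : ℂ) * (resCard K : ℂ) ^ (-s))⁻¹ else 1

/-- Schwartz-Bruhat functions: locally constant with compact support. -/
def IsSchwartzBruhat (g : K → ℂ) : Prop := IsLocallyConstant g ∧ HasCompactSupport g

/-- A local field has no infinitely divisible units other than `1`. -/
lemma eq_one_of_divisible (x : Kˣ) (hx : ∀ l : ℕ+, ∃ y : Kˣ, y ^ (l : ℕ) = x) : x = 1 := by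
  have hv0 : ∀ y : Kˣ, valuation K (y : K) ≠ 0 := fun y => by simp
  set e := IsNonarchimedeanLocalField.valueGroupWithZeroIsoInt K with he
  have he0 : ∀ y : Kˣ, e (valuation K (y : K)) ≠ 0 := fun y => by
    simp
  have hpow : ∀ (y : Kˣ) (n : ℕ), ord ((y ^ n : Kˣ) : K) = n * ord (y : K) := by
    intro y n
    simp [ord]
  have h1 : ∀ y : Kˣ, ord (y : K) = 0 → valuation K (y : K) = 1 := by
    intro y hy
    have : WithZero.log (e (valuation K (y : K))) = 0 := by simpa [ord] using hy
    have h2 := WithZero.exp_log (he0 y)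
    rw [this, WithZero.exp_zero] at h2
    have : e (valuation K (y : K)) = e 1 := by rw [← h2, map_one]
    exact e.injective this
  have hx0 : ord (x : K) = 0 := by
    obtain ⟨y, hy⟩ := hx ⟨(ord (x : K)).natAbs + 1, by omega⟩
    have := hpow y ((ord (x : K)).natAbs + 1)
    rw [PNat.mk_coe] at hy
    rw [hy] at this
    by_contra hne
    have hd : (((ord (x : K)).natAbs + 1 : ℕ) : ℤ) ∣ ord (x : K) := ⟨_, this⟩
    have := Int.le_of_dvd (by simpa using hne) ((dvd_abs _ _).2 hd)
    rw [Int.abs_eq_natAbs] at this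
    push_cast at this
    omega
  have key : ∀ n : ℕ, ∃ z : (valuation K).integer,
      (z : K) = x ∧ z - 1 ∈ (IsLocalRing.maximalIdeal (valuation K).integer) ^ n := by
    intro n
    have : Finite ((valuation K).integer ⧸
        (IsLocalRing.maximalIdeal (valuation K).integer) ^ n) := by
      have : Finite ((valuation K).integer ⧸
        (IsLocalRing.maximalIdeal (valuation K).integer)) :=
        inferInstanceAs (Finite (IsLocalRing.ResidueField (valuation K).integer))
      exact Ideal.finite_quotient_pow (IsNoetherian.noetherian _) n
    set R := (valuation K).integer ⧸ (IsLocalRing.maximalIdeal (valuation K).integer) ^ n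
    obtain ⟨y, hy⟩ := hx ⟨Nat.card Rˣ, Nat.card_pos⟩
    rw [PNat.mk_coe] at hy
    have hy0 : ord (y : K) = 0 := by
      have := hpow y (Nat.card Rˣ)
      rw [hy, hx0] at this
      have hc : (Nat.card Rˣ : ℤ) ≠ 0 := by exact_mod_cast Nat.card_pos.ne'
      rcases mul_eq_zero.1 this.symm with h | h
      · exact absurd h hc
      · exact h
    have hyv := h1 y hy0
    have hyv' : valuation K ((y⁻¹ : Kˣ) : K) = 1 := by
      simp [hyv]
    let u : ((valuation K).integer)ˣ :=
      ⟨⟨(y : K), hyv.le⟩, ⟨((y⁻¹ : Kˣ) : K), hyv'.le⟩, by ext; simp, by ext; simp⟩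
    refine ⟨(u : (valuation K).integer) ^ (Nat.card Rˣ), ?_, ?_⟩
    · rw [← hy]; simp [u]
    · rw [← Ideal.Quotient.eq_zero_iff_mem, map_sub, map_pow, map_one, sub_eq_zero]
      have := pow_card_eq_one' (x := Units.map
        (Ideal.Quotient.mk ((IsLocalRing.maximalIdeal (valuation K).integer) ^ n)).toMonoidHom u)
      exact congrArg Units.val this
  obtain ⟨z, hz, -⟩ := key 0
  have hz1 : z - 1 = 0 := by
    have : z - 1 ∈ (⨅ n : ℕ, (IsLocalRing.maximalIdeal (valuation K).integer) ^ n) := by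
      rw [Ideal.mem_iInf]
      intro n
      obtain ⟨z', hz', hm⟩ := key n
      have : z' = z := Subtype.ext (hz'.trans hz.symm)
      rwa [← this]
    rwa [Ideal.iInf_pow_eq_bot_of_isLocalRing _ (Ideal.IsPrime.ne_top'), Ideal.mem_bot] at this
  ext
  rw [← hz, sub_eq_zero.1 hz1]
  rfl

end OneDim

/-! ## The second topological Milnor `K`-group -/

section MilnorK

variable (F : Type*) [Field F]

/-- The subgroup of `Fˣ ⊗ Fˣ` generated by the Steinberg elements `a ⊗ (1 - a)`. -/
def steinberg : AddSubgroup (Additive Fˣ ⊗[ℤ] Additive Fˣ) :=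
  AddSubgroup.closure
    {z | ∃ a b : Fˣ, (a : F) + b = 1 ∧ z = Additive.ofMul a ⊗ₜ[ℤ] Additive.ofMul b}

/-- The second Milnor `K`-group of a field. -/
abbrev MilnorK2 := (Additive Fˣ ⊗[ℤ] Additive Fˣ) ⧸ steinberg F

/-- The subgroup `⋂_{l ≥ 1} l K₂(F)` of infinitely divisible elements. -/
def divisibleK2 : AddSubgroup (MilnorK2 F) :=
  ⨅ l : ℕ+, (nsmulAddMonoidHom (α := MilnorK2 F) (l : ℕ)).range

/-- The topological `K`-group `K₂ᵗ(F) = K₂(F) / ⋂_{l ≥ 1} l K₂(F)` of a two-dimensional local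
field. (The subgroup divided out is the intersection of all neighbourhoods of `0` in `K₂(F)`.) -/
abbrev TopK2 := MilnorK2 F ⧸ divisibleK2 F

variable {F}

/-- The class of the symbol `{a, b}` in `K₂ᵗ(F)`. -/
def symb (a b : Fˣ) : TopK2 F :=
  QuotientAddGroup.mk' (divisibleK2 F)
    (QuotientAddGroup.mk' (steinberg F) (Additive.ofMul a ⊗ₜ[ℤ] Additive.ofMul b))

end MilnorK

/-! ## Two-dimensional local fields -/

/-- `F` (equipped with a `ℤ`-valued valuation `ν`, with respect to which it will be assumed to be
complete) has the local field `K` as residue field, through the residue map `res`, and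
`t₁, t₂` are local parameters: `ν(t₂) = 1`, `t₁` is a `ν`-unit and its residue is a prime
of `K`. -/
structure LocalParams (F K : Type*) [Field F] [Valued F ℤᵐ⁰] [Field K] [ValuativeRel K]
    [TopologicalSpace K] [IsNonarchimedeanLocalField K] where
  /-- the residue map `𝒪_F → K` -/
  res : Valued.integer F →+* K
  res_surjective : Function.Surjective res
  /-- the first local parameter -/
  t₁ : Fˣ
  /-- the second local parameter -/
  t₂ : Fˣ
  val_t₁ : Valued.v (t₁ : F) = (1 : ℤᵐ⁰)
  val_t₂ : Valued.v (t₂ : F) = WithZero.exp (-1 : ℤ)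
  ord_res_t₁ : ord (res ⟨(t₁ : F), val_t₁.le⟩) = 1

section TwoDim

variable {F : Type*} [Field F] [Valued F ℤᵐ⁰]

/-- The additive valuation `ν : Fˣ → ℤ`. -/
def nu (x : Fˣ) : ℤ := -WithZero.log (Valued.v (x : F) : ℤᵐ⁰)

lemma val_eq_exp (x : Fˣ) : (Valued.v (x : F) : ℤᵐ⁰) = WithZero.exp (-nu x) := by
  rw [nu, neg_neg, WithZero.exp_log]; simp

lemma nu_eq_of_val {x : Fˣ} {n : ℤ} (h : (Valued.v (x : F) : ℤᵐ⁰) = WithZero.exp (-n)) :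
    nu x = n := by
  rw [nu, h, WithZero.log_exp, neg_neg]

lemma nu_mul (x y : Fˣ) : nu (x * y) = nu x + nu y := by
  rw [nu, nu, nu, Units.val_mul, map_mul, WithZero.log_mul (by simp) (by simp)]; ring

lemma nu_one : nu (1 : Fˣ) = 0 := by simp [nu]

namespace LocalParams

variable {K : Type*} [Field K] [ValuativeRel K] [TopologicalSpace K]
  [IsNonarchimedeanLocalField K] (D : LocalParams F K)

open Classical in
/-- The residue map extended by zero from `𝒪_F` to `F`. -/
def resExt (z : F) : K := if h : (Valued.v z : ℤᵐ⁰) ≤ 1 then D.res ⟨z, h⟩ else 0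

lemma resExt_of_le {z : F} (h : (Valued.v z : ℤᵐ⁰) ≤ 1) : D.resExt z = D.res ⟨z, h⟩ := dif_pos h

lemma resExt_mul {z z' : F} (h : (Valued.v z : ℤᵐ⁰) ≤ 1) (h' : (Valued.v z' : ℤᵐ⁰) ≤ 1) :
    D.resExt (z * z') = D.resExt z * D.resExt z' := by
  have : (Valued.v (z * z') : ℤᵐ⁰) ≤ 1 := by rw [map_mul]; exact mul_le_one' h h'
  rw [D.resExt_of_le h, D.resExt_of_le h', D.resExt_of_le this, ← map_mul]; rfl

lemma resExt_add {z z' : F} (h : (Valued.v z : ℤᵐ⁰) ≤ 1) (h' : (Valued.v z' : ℤᵐ⁰) ≤ 1) :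
    D.resExt (z + z') = D.resExt z + D.resExt z' := by
  have : (Valued.v (z + z') : ℤᵐ⁰) ≤ 1 := (Valuation.map_add _ _ _).trans (max_le h h')
  rw [D.resExt_of_le h, D.resExt_of_le h', D.resExt_of_le this, ← map_add]; rfl

lemma resExt_one : D.resExt 1 = 1 := by
  rw [D.resExt_of_le (by simp), ← map_one D.res]; rfl

lemma resExt_of_lt {z : F} (h : (Valued.v z : ℤᵐ⁰) < 1) : D.resExt z = 0 := by
  by_contra hne
  obtain ⟨y, hy⟩ := D.res_surjective (D.resExt z)⁻¹
  have h1 : D.res (⟨z, h.le⟩ * y - 1) = 0 := by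
    rw [map_sub, map_mul, hy, ← D.resExt_of_le h.le, mul_inv_cancel₀ hne, map_one, sub_self]
  have hv : (Valued.v (z * (y : F)) : ℤᵐ⁰) < 1 := by
    rw [map_mul]; exact mul_lt_one_of_lt_of_le h y.2
  have hu : (Valued.v (z * (y : F) - 1) : ℤᵐ⁰) = 1 := by
    rw [Valuation.map_sub_eq_of_lt_right _ (by simpa using hv), map_one]
  have hne0 : z * (y : F) - 1 ≠ 0 := by
    intro h0; rw [h0, map_zero] at hu; exact zero_ne_one hu
  have hinv : (Valued.v (z * (y : F) - 1)⁻¹ : ℤᵐ⁰) ≤ 1 := by rw [map_inv₀, hu, inv_one]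
  have h2 : (⟨z, h.le⟩ * y - 1) * (⟨(z * (y : F) - 1)⁻¹, hinv⟩ : Valued.integer F) = 1 := by
    ext; exact mul_inv_cancel₀ hne0
  have h3 := congrArg D.res h2
  rw [map_mul, h1, zero_mul, map_one] at h3
  exact zero_ne_one h3

/-- `x t₂^(-ν(x))`, a unit of `𝒪_F`. -/
def unitPart (x : Fˣ) : Fˣ := x * D.t₂ ^ (-nu x)

lemma val_t₂_zpow (n : ℤ) :
    (Valued.v ((D.t₂ ^ n : Fˣ) : F) : ℤᵐ⁰) = WithZero.exp (-n) := by
  rw [Units.val_zpow_eq_zpow_val, map_zpow₀, D.val_t₂, ← WithZero.exp_zsmul]; simp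

lemma val_unitPart (x : Fˣ) : (Valued.v (D.unitPart x : F) : ℤᵐ⁰) = 1 := by
  rw [unitPart, Units.val_mul, map_mul, D.val_t₂_zpow, val_eq_exp, ← WithZero.exp_add]; simp

lemma unitPart_mul (x y : Fˣ) : D.unitPart (x * y) = D.unitPart x * D.unitPart y := by
  rw [unitPart, unitPart, unitPart, nu_mul, neg_add, zpow_add]
  exact mul_mul_mul_comm _ _ _ _

lemma unitPart_one : D.unitPart 1 = 1 := by simp [unitPart, nu_one]

/-- The homomorphism `η : Fˣ → Kˣ`, `η(x) = res (x t₂^(-ν(x)))`. On units of `𝒪_F` it is the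
residue map. -/
def eta : Fˣ →* Kˣ where
  toFun x := ⟨D.resExt (D.unitPart x), D.resExt (D.unitPart x⁻¹),
    by rw [← D.resExt_mul (D.val_unitPart _).le (D.val_unitPart _).le, ← Units.val_mul,
        ← unitPart_mul, mul_inv_cancel, unitPart_one, Units.val_one, resExt_one],
    by rw [← D.resExt_mul (D.val_unitPart _).le (D.val_unitPart _).le, ← Units.val_mul,
        ← unitPart_mul, inv_mul_cancel, unitPart_one, Units.val_one, resExt_one]⟩
  map_one' := by ext; simp [unitPart_one, resExt_one]
  map_mul' x y := by
    ext
    simp only [unitPart_mul, Units.val_mul]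
    exact D.resExt_mul (D.val_unitPart _).le (D.val_unitPart _).le

lemma coe_eta (x : Fˣ) : (D.eta x : K) = D.resExt (D.unitPart x) := rfl

lemma eta_of_nu_zero {x : Fˣ} (h : nu x = 0) : (D.eta x : K) = D.resExt x := by
  rw [coe_eta, unitPart, h]; simp

/-- The tame symbol `(-1)^(ν(a)ν(b)) res (a^ν(b) b^(-ν(a)))`. -/
def tame (a b : Fˣ) : Kˣ := (-1) ^ (nu a * nu b) * (D.eta a ^ nu b * (D.eta b ^ nu a)⁻¹)

lemma tame_mul_left (a a' b : Fˣ) : D.tame (a * a') b = D.tame a b * D.tame a' b := by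
  simp only [tame, nu_mul, map_mul, add_mul, zpow_add, mul_zpow, mul_inv]
  simp only [mul_assoc, mul_left_comm]

lemma tame_mul_right (a b b' : Fˣ) : D.tame a (b * b') = D.tame a b * D.tame a b' := by
  simp only [tame, nu_mul, map_mul, mul_add, zpow_add, mul_zpow, mul_inv]
  simp only [mul_assoc, mul_left_comm]

lemma tame_aux {a b : Fˣ} (h : (a : F) + b = 1) (ha : (Valued.v (a : F) : ℤᵐ⁰) < 1) :
    nu b = 0 ∧ D.eta b = 1 := by
  have hb : (b : F) = 1 - a := by rw [← h]; ring
  have hvb : (Valued.v (b : F) : ℤᵐ⁰) = 1 := by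
    rw [hb, Valuation.map_sub_eq_of_lt_left _ (by simpa using ha), map_one]
  have hn : nu b = 0 := nu_eq_of_val (by rw [hvb]; simp)
  refine ⟨hn, ?_⟩
  ext
  have := D.resExt_add ha.le hvb.le
  rw [h, resExt_one, D.resExt_of_lt ha, zero_add] at this
  rw [D.eta_of_nu_zero hn, ← this]; rfl

lemma tame_steinberg {a b : Fˣ} (h : (a : F) + b = 1) : D.tame a b = 1 := by
  rcases lt_trichotomy (Valued.v (a : F) : ℤᵐ⁰) 1 with ha | ha | ha
  · obtain ⟨h1, h2⟩ := D.tame_aux h ha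
    simp [tame, h1, h2]
  · have hna : nu a = 0 := nu_eq_of_val (by rw [ha]; simp)
    rcases lt_or_ge (Valued.v (b : F) : ℤᵐ⁰) 1 with hb | hb
    · obtain ⟨h1, h2⟩ := D.tame_aux ((add_comm _ _).trans h) hb
      simp [tame, h1, h2]
    · have hb' : (Valued.v (b : F) : ℤᵐ⁰) = 1 := by
        refine le_antisymm ?_ hb
        have : (b : F) = 1 - a := by rw [← h]; ring
        rw [this]
        exact (Valuation.map_sub _ _ _).trans (by simp [ha])
      have hnb : nu b = 0 := nu_eq_of_val (by rw [hb']; simp)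
      simp [tame, hna, hnb]
  · have hb : (b : F) = 1 - a := by rw [← h]; ring
    have hvb : (Valued.v (b : F) : ℤᵐ⁰) = Valued.v (a : F) := by
      rw [hb, Valuation.map_sub_eq_of_lt_right _ (by simpa using ha)]
    have hn : nu b = nu a := by rw [nu, nu, hvb]
    have hneg : nu a < 0 := by
      rw [val_eq_exp, ← WithZero.exp_zero, WithZero.exp_lt_exp] at ha; omega
    have hsum : (D.unitPart a : F) + D.unitPart b = ((D.t₂ ^ (-nu a) : Fˣ) : F) := by
      rw [unitPart, unitPart, hn, Units.val_mul, Units.val_mul, ← add_mul, h, one_mul]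
    have heta : D.eta a = -D.eta b := by
      ext
      rw [Units.val_neg, coe_eta, coe_eta, eq_neg_iff_add_eq_zero,
        ← D.resExt_add (D.val_unitPart _).le (D.val_unitPart _).le, hsum]
      apply D.resExt_of_lt
      rw [D.val_t₂_zpow, ← WithZero.exp_zero, WithZero.exp_lt_exp]; omega
    rw [tame, hn, heta]
    rcases Int.even_or_odd (nu a) with he | ho
    · rw [he.neg_zpow, (he.mul_left _).neg_one_zpow]; simp
    · rw [ho.neg_zpow, (ho.mul ho).neg_one_zpow]; simp

/-- The tame symbol as a biadditive map. -/
def tameHom : Additive Fˣ →+ Additive Fˣ →+ Additive Kˣ :=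
  AddMonoidHom.mk'
    (fun a => AddMonoidHom.mk' (fun b => Additive.ofMul (D.tame a.toMul b.toMul))
      fun b b' => congrArg Additive.ofMul (D.tame_mul_right a.toMul b.toMul b'.toMul))
    fun a a' => AddMonoidHom.ext fun b =>
      congrArg Additive.ofMul (D.tame_mul_left a.toMul a'.toMul b.toMul)

/-- The border map `K₂(F) → Kˣ` given by the tame symbol. -/
def borderMilnor : MilnorK2 F →+ Additive Kˣ :=
  QuotientAddGroup.lift (steinberg F)
    (TensorProduct.liftAddHom D.tameHom fun r a b => by simp)
    (by
      rw [steinberg, AddSubgroup.closure_le]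
      rintro _ ⟨a, b, h, rfl⟩
      simp only [SetLike.mem_coe, AddMonoidHom.mem_ker, TensorProduct.liftAddHom_tmul]
      exact congrArg Additive.ofMul (D.tame_steinberg h))

/-- The border map `∂ : K₂ᵗ(F) → Kˣ`. -/
def border : TopK2 F →+ Additive Kˣ :=
  QuotientAddGroup.lift (divisibleK2 F) D.borderMilnor (by
    intro z hz
    rw [AddMonoidHom.mem_ker]
    refine congrArg Additive.ofMul (eq_one_of_divisible (D.borderMilnor z).toMul fun l => ?_)
    obtain ⟨y, hy⟩ := AddSubgroup.mem_iInf.1 hz l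
    exact ⟨(D.borderMilnor y).toMul, by rw [← hy]; simp⟩)

lemma border_symb (a b : Fˣ) : D.border (symb a b) = Additive.ofMul (D.tame a b) := rfl

/-- The quasi-character `ω ∘ ∂` of `K₂ᵗ(F)` attached to a quasi-character `ω` of `Kˣ`. -/
def pullChar (ω : Kˣ →ₜ* ℂˣ) : TopK2 F →+ Additive ℂˣ :=
  (MonoidHom.toAdditive (ω : Kˣ →* ℂˣ)).comp D.border

/-- The absolute value `|ξ| = |∂ ξ|` on `K₂ᵗ(F)`. -/
def absK2 (ξ : TopK2 F) : ℝ := nabs ((D.border ξ).toMul : K)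

/-- The homomorphism `𝔱 : T = 𝒪_Fˣ × 𝒪_Fˣ → K₂ᵗ(F)`,
`(t₁^i u, t₁^j v) ↦ (i + j){t₁, t₂} + {u, t₂} + {t₁, v}` (where the residues of `u`, `v` are units
of `𝒪_K`). The formula is used only for arguments in `T`, where `i = w(η(x))` and `j = w(η(y))`. -/
def tmap (x y : Fˣ) : TopK2 F :=
  (ord (D.eta x : K) + ord (D.eta y : K)) • symb D.t₁ D.t₂
    + symb (x * D.t₁ ^ (-ord (D.eta x : K))) D.t₂
    + symb D.t₁ (y * D.t₁ ^ (-ord (D.eta y : K)))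

/-- The generalised residue map
`ρ₂ : (t₁^i₁ t₂^i₂ u, t₁^j₁ t₂^j₂ v) ↦ res (t₁^min(i₁,j₁) t₂^min(i₂,j₂) u)`, for pairs of nonzero
elements of `𝒪_F`; here `i₂ = ν(x)`, `i₁ = w(η(x))`, `u = t₁^(-i₁) t₂^(-i₂) x`, and similarly
for `y`. -/
def rho2 (p : Fˣ × Fˣ) : K :=
  let i₁ := ord (D.eta p.1 : K)
  let j₁ := ord (D.eta p.2 : K)
  let i₂ := nu p.1
  let j₂ := nu p.2
  D.resExt ((D.t₁ ^ min i₁ j₁ * D.t₂ ^ min i₂ j₂ * (p.1 * D.t₁ ^ (-i₁) * D.t₂ ^ (-i₂)) : Fˣ) : F)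

/-! ### Integration on `F × F` with values in `ℂ(X)` -/

open Classical in
/-- The lift of `g : K × K → ℂ` at `(a₁, a₂), (γ₁, γ₂)`: it vanishes off
`(a₁ + t₂^γ₁ 𝒪_F) × (a₂ + t₂^γ₂ 𝒪_F)`, where it is
`g(res ((x₁ - a₁) t₂^(-γ₁)), res ((x₂ - a₂) t₂^(-γ₂)))`. -/
def lift (g : K × K → ℂ) (a : F × F) (γ : ℤ × ℤ) (x : F × F) : ℂ :=
  let y₁ : F := (x.1 - a.1) * ((D.t₂ ^ (-γ.1) : Fˣ) : F)
  let y₂ : F := (x.2 - a.2) * ((D.t₂ ^ (-γ.2) : Fˣ) : F)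
  if (Valued.v y₁ : ℤᵐ⁰) ≤ 1 ∧ (Valued.v y₂ : ℤᵐ⁰) ≤ 1 then g (D.resExt y₁, D.resExt y₂) else 0

variable [MeasurableSpace K] (μ : Measure K)

/-- The graph of the `ℂ(X)`-linear integral on the space of integrable functions on `F × F`:
the `ℂ(X)`-span of the pairs consisting of the lift of a Haar integrable `g : K × K → ℂ` at
`a, γ` and of its integral `(∫∫ g) X^(γ₁ + γ₂)`. -/
def integralGraph : Submodule (RatFunc ℂ) ((F × F → RatFunc ℂ) × RatFunc ℂ) :=
  Submodule.span (RatFunc ℂ)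
    {z | ∃ (g : K × K → ℂ) (a : F × F) (γ : ℤ × ℤ), Integrable g (μ.prod μ) ∧
      z = (fun x => RatFunc.C (D.lift g a γ x),
        RatFunc.C (∫ u, g u ∂(μ.prod μ)) * RatFunc.X ^ (γ.1 + γ.2))}

/-- `f` is integrable on `F × F` with integral `I`. -/
def HasIntegral (f : F × F → RatFunc ℂ) (I : RatFunc ℂ) : Prop := (f, I) ∈ D.integralGraph μ

/-- The absolute value `|x| = |η(x)| X^ν(x)` on `Fˣ`, with values in `ℂ(X)`. -/
def absF (x : Fˣ) : RatFunc ℂ := RatFunc.C (nabs (D.eta x : K) : ℂ) * RatFunc.X ^ nu x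

/-- `φ` is integrable on `Fˣ × Fˣ` with integral `I`: the function `φ(x, y) |x|⁻¹ |y|⁻¹` extends
to an integrable function on `F × F` with integral `I`. -/
def HasMulIntegral (φ : Fˣ × Fˣ → RatFunc ℂ) (I : RatFunc ℂ) : Prop :=
  ∃ f : F × F → RatFunc ℂ,
    (∀ x y : Fˣ, f (x, y) = φ (x, y) * (D.absF x)⁻¹ * (D.absF y)⁻¹) ∧ D.HasIntegral μ f I

open Classical in
/-- The integrand `f(x,y) χ(𝔱(x,y)) |𝔱(x,y)|^s char_T(x,y)`. -/
def zetaIntegrand (f : Fˣ × Fˣ → RatFunc ℂ) (χ : TopK2 F →+ Additive ℂˣ) (s : ℂ)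
    (p : Fˣ × Fˣ) : RatFunc ℂ :=
  if nu p.1 = 0 ∧ nu p.2 = 0 then
    f p * RatFunc.C (((χ (D.tmap p.1 p.2)).toMul : ℂ) * (D.absK2 (D.tmap p.1 p.2) : ℂ) ^ s)
  else 0

/-- The integrand of the two-dimensional zeta integral `ζ(f, χ, s)` is integrable on `Fˣ × Fˣ`,
with integral `I`. -/
def HasZetaIntegral (f : Fˣ × Fˣ → RatFunc ℂ) (χ : TopK2 F →+ Additive ℂˣ) (s : ℂ)
    (I : RatFunc ℂ) : Prop :=
  D.HasMulIntegral μ (D.zetaIntegrand f χ s) I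

open Classical in
/-- The two-dimensional zeta integral `ζ(f, χ, s)` (junk value `0` if it is not defined). -/
def zeta (f : Fˣ × Fˣ → RatFunc ℂ) (χ : TopK2 F →+ Additive ℂˣ) (s : ℂ) : RatFunc ℂ :=
  if h : ∃ I, D.HasZetaIntegral μ f χ s I then h.choose else 0

/-- The `ℂ(X)`-valued function `g ∘ ρ₂`. -/
def compRho (g : K → ℂ) (p : Fˣ × Fˣ) : RatFunc ℂ := RatFunc.C (g (D.rho2 p))

/-- The prime `π = res t₁` of `K`, as a unit of `K`. -/
def prime : Kˣ := D.eta D.t₁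

end LocalParams

end TwoDim

end TwoDimZeta

end

open TwoDimZeta

/-! Write `Q = ω(π) q^(-s)`. On `T` the integrand depends only on the residues of `x` and `y`,
because `∂(𝔱(x, y)) = π^(w(η(y))) η(x)` and `ρ₂` is likewise a function of `η(x)` and `η(y)`. It is
therefore the lift at `(0, 0)` of one function on `K × K`, and the zeta integral is an ordinary
double integral over `Kˣ × Kˣ` (`hasZetaIntegral_of_integrable`). A measure-preserving shear, chosen
so that the minimum of the two orders becomes the order of one new variable `z`, splits the
integrand as `Q^|ord y|` times a function of `z` (`doubleIntegrand_ordShear`). The first factor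
integrates to the volume of the units times `∑ Q^|n| = (1 + Q)/(1 - Q)`; the second gives the
one-dimensional zeta integral.

Uniqueness of the integral is a separate matter, since a function may be a combination of lifts in
many ways and its extension to the axes is arbitrary. Pull a vanishing combination of lifts back to
one product of cosets, with coordinates in `K × K`. Lifts from that product become translates of
their `g`; every other lift becomes, almost everywhere, a sum of functions of one variable. An
integrable function on `K × K` of the form `h₁(u) + h₂(v)` has integral zero because `K` has
infinite measure (`integral_prod_eq_zero_of_ae_eq_add`), so the integrals cancel product by product
(`sum_integral_eq_zero`).

For Schwartz–Bruhat `g`, the integral over `z` is a Laurent polynomial in `Q` plus `g(0)` times a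
tail near zero. The tail vanishes for ramified `ω` and has denominator `1 - Q²` otherwise; together
with `(1 + Q)/(1 - Q)` these denominators are cancelled exactly by the `L`-factors. -/

noncomputable section

namespace TwoDimZeta

/-! ### Order, absolute value and the scaling of Haar measure on a local field -/

section LocalField

variable {K : Type*} [Field K] [ValuativeRel K] [TopologicalSpace K]
  [IsNonarchimedeanLocalField K]

open IsNonarchimedeanLocalField in
variable (K) in
-- A rank-one valuation makes `K` a proper metric space. Only the two topological consequences are
-- kept; they are what Borel measurability on `K × K` requires.
lemma secondCountable_and_t2 : SecondCountableTopology K ∧ T2Space K := by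
  let := IsTopologicalAddGroup.rightUniformSpace K
  have := isUniformAddGroup_of_addCommGroup (G := K)
  let : (Valued.v (R := K)).RankOne :=
  { hom' := IsRankLeOne.nonempty.some.emb (R := K).comp MonoidWithZeroHom.ValueGroup₀.embedding
    strictMono' := IsRankLeOne.nonempty.some.strictMono.comp
        MonoidWithZeroHom.ValueGroup₀.embedding_strictMono }
  open scoped Valued in
  have : ProperSpace K := .of_nontriviallyNormedField_of_weaklyLocallyCompactSpace K
  exact ⟨inferInstance, inferInstance⟩

instance : SecondCountableTopology K := (secondCountable_and_t2 K).1

instance : T2Space K := (secondCountable_and_t2 K).2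

lemma exp_neg_ord (x : Kˣ) :
    IsNonarchimedeanLocalField.valueGroupWithZeroIsoInt K (valuation K (x : K)) =
      WithZero.exp (-ord (x : K)) := by
  rw [ord, neg_neg, WithZero.exp_log]
  simp

@[simp]
lemma ord_mul (x y : Kˣ) : ord ((x * y : Kˣ) : K) = ord (x : K) + ord (y : K) := by
  have h := exp_neg_ord (x * y)
  rw [Units.val_mul, map_mul, map_mul, exp_neg_ord, exp_neg_ord, ← WithZero.exp_add,
    WithZero.exp_inj] at h
  rw [Units.val_mul]
  omega

variable (K) in
/-- The valuation `ord` as a homomorphism on `Kˣ`. -/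
def ordHom : Kˣ →* Multiplicative ℤ where
  toFun x := Multiplicative.ofAdd (ord (x : K))
  map_one' := by simp [ord]
  map_mul' x y := by rw [ord_mul, ofAdd_add]

@[simp]
lemma ord_unit_one : ord ((1 : Kˣ) : K) = 0 := by simp [ord]

@[simp]
lemma ord_inv (x : Kˣ) : ord ((x⁻¹ : Kˣ) : K) = -ord (x : K) :=
  congrArg Multiplicative.toAdd (map_inv (ordHom K) x)

@[simp]
lemma ord_zpow (x : Kˣ) (n : ℤ) : ord ((x ^ n : Kˣ) : K) = n * ord (x : K) := by
  have := congrArg Multiplicative.toAdd (map_zpow (ordHom K) x n)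
  simpa [ordHom] using this

variable (K) in
lemma exists_ord_eq_one : ∃ ϖ : Kˣ, ord (ϖ : K) = 1 := by
  let e := IsNonarchimedeanLocalField.valueGroupWithZeroIsoInt K
  obtain ⟨x, hx⟩ := ValuativeRel.valuation_surjective (e.symm (WithZero.exp (-1 : ℤ)))
  have hex : e (valuation K x) = WithZero.exp (-1 : ℤ) := by
    rw [hx]
    exact e.apply_symm_apply _
  have hx0 : x ≠ 0 := by
    rintro rfl
    rw [map_zero, map_zero] at hex
    exact WithZero.exp_ne_zero hex.symm
  refine ⟨Units.mk0 x hx0, ?_⟩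
  rw [Units.val_mk0, ord, hex, WithZero.log_exp, neg_neg]

lemma valuation_le_iff (x y : Kˣ) :
    valuation K (x : K) ≤ valuation K (y : K) ↔ ord (y : K) ≤ ord (x : K) := by
  rw [← map_le_map_iff (IsNonarchimedeanLocalField.valueGroupWithZeroIsoInt K), exp_neg_ord,
    exp_neg_ord, WithZero.exp_le_exp, neg_le_neg_iff]

lemma valuation_le_one_iff (x : Kˣ) : valuation K (x : K) ≤ 1 ↔ 0 ≤ ord (x : K) := by
  have := valuation_le_iff x 1
  rwa [ord_unit_one, Units.val_one, map_one] at this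

lemma valuation_eq_one_iff (x : Kˣ) : valuation K (x : K) = 1 ↔ ord (x : K) = 0 := by
  have := valuation_le_one_iff x⁻¹
  rw [ord_inv, Units.val_inv_eq_inv_val, map_inv₀, inv_le_one₀ (by simp [zero_lt_iff])] at this
  rw [le_antisymm_iff, valuation_le_one_iff, this]
  omega

lemma valuation_lt_one_iff (x : Kˣ) : valuation K (x : K) < 1 ↔ 1 ≤ ord (x : K) := by
  rw [lt_iff_le_and_ne, valuation_le_one_iff, Ne, valuation_eq_one_iff]
  omega

lemma continuous_ord : Continuous fun x : Kˣ => ord (x : K) := by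
  rw [continuous_discrete_rng]
  intro n
  rw [isOpen_iff_mem_nhds]
  intro x hx
  have hx0 : valuation K (x : K) ≠ 0 := by simp
  have h := Units.continuous_val.continuousAt.preimage_mem_nhds
    ((valuation K).locally_const hx0)
  refine Filter.mem_of_superset h fun y hy => ?_
  have hy' : valuation K (y : K) = valuation K (x : K) := hy
  simp only [Set.mem_preimage, Set.mem_singleton_iff] at hx ⊢
  rw [← hx, ord, hy', ord]

variable (K) in
lemma one_lt_resCard : 1 < resCard K := by
  have : Finite (IsLocalRing.ResidueField (valuation K).integer) :=
    inferInstanceAs (Finite (IsLocalRing.ResidueField (Valuation.integer (valuation K))))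
  exact Finite.one_lt_card

variable (K) in
lemma resCard_pos : (0 : ℝ) < resCard K := by
  exact_mod_cast zero_lt_one.trans (one_lt_resCard K)

lemma nabs_unit (x : Kˣ) : nabs (x : K) = (resCard K : ℝ) ^ (-ord (x : K)) := by
  rw [nabs, if_neg x.ne_zero]

lemma nabs_pos (x : Kˣ) : 0 < nabs (x : K) := by
  rw [nabs_unit]
  exact zpow_pos (resCard_pos K) _

lemma nabs_mul (x y : Kˣ) : nabs ((x * y : Kˣ) : K) = nabs (x : K) * nabs (y : K) := by
  rw [nabs_unit, nabs_unit, nabs_unit, ord_mul, neg_add, zpow_add₀ (resCard_pos K).ne']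

/-- The base `q` has argument zero, so the principal branch causes no correction. All dependence on
`s` thereby passes through `q^(-s)`. -/
lemma nabs_cpow (x : Kˣ) (s : ℂ) :
    (nabs (x : K) : ℂ) ^ s = ((resCard K : ℂ) ^ (-s)) ^ ord (x : K) := by
  have h := Complex.natCast_arg (n := resCard K)
  rw [nabs_unit, ← Complex.cpow_int_mul, mul_neg, ← neg_mul, ← Int.cast_neg,
    Complex.cpow_int_mul' (by simp [h, Real.pi_pos]) (by simp [h, Real.pi_pos.le])]
  push_cast
  rfl

lemma continuous_nabs : Continuous fun x : Kˣ => nabs (x : K) := by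
  simp_rw [nabs_unit]
  exact (continuous_of_discreteTopology (f := fun n : ℤ => (resCard K : ℝ) ^ (-n))).comp
    continuous_ord

variable [MeasurableSpace K] [BorelSpace K]

instance : BorelSpace Kˣ where
  measurable_eq := by
    rw [Units.isEmbedding_val₀.eq_induced, borel_comap, ← BorelSpace.measurable_eq (α := K)]
    rfl

omit [TopologicalSpace K] [IsNonarchimedeanLocalField K] [MeasurableSpace K] [BorelSpace K]
  [ValuativeRel K] in
lemma range_units_val : Set.range (Units.val : Kˣ → K) = {0}ᶜ := by
  ext x
  exact ⟨by rintro ⟨u, rfl⟩; exact u.ne_zero, fun h => ⟨Units.mk0 x h, rfl⟩⟩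

lemma measurableEmbedding_val : MeasurableEmbedding (Units.val : Kˣ → K) := by
  apply Topology.IsEmbedding.measurableEmbedding Units.isEmbedding_val₀
  rw [range_units_val]
  exact (measurableSet_singleton 0).compl

lemma measurable_ord : Measurable fun x : Kˣ => ord (x : K) := continuous_ord.measurable

instance : SecondCountableTopology Kˣ := Units.isEmbedding_val₀.secondCountableTopology

lemma measurable_nabs : Measurable (nabs : K → ℝ) := by
  have h := measurableEmbedding_val.measurable_extend
    (continuous_nabs (K := K)).measurable (measurable_const (a := (0 : ℝ)))
  convert! h
  ext x
  by_cases hx : x = 0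
  · rw [Function.extend_apply']
    · simp [nabs, hx]
    · rintro ⟨u, hu⟩
      exact u.ne_zero (hu.trans hx)
  · exact (Units.val_injective.extend_apply (fun x : Kˣ => nabs (x : K)) _ (Units.mk0 x hx)).symm

open scoped Pointwise

omit [MeasurableSpace K] [BorelSpace K] in
lemma smul_integer_of_ord_eq_zero (u : Kˣ) (hu : ord (u : K) = 0) :
    u • ((valuation K).integer : Set K) = (valuation K).integer := by
  ext x
  rw [Set.mem_smul_set_iff_inv_smul_mem, Units.smul_def, smul_eq_mul, SetLike.mem_coe,
    SetLike.mem_coe, Valuation.mem_integer_iff, Valuation.mem_integer_iff, map_mul,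
    (valuation_eq_one_iff u⁻¹).2 (by rw [ord_inv, hu, neg_zero]), one_mul]

variable (μ : Measure K) [μ.IsAddHaarMeasure]

omit [BorelSpace K] in
lemma measure_integer_ne_top : μ ((valuation K).integer : Set K) ≠ ⊤ :=
  (IsNonarchimedeanLocalField.isCompact_closedBall K 1).measure_lt_top.ne

omit [BorelSpace K] in
lemma measure_integer_ne_zero : μ ((valuation K).integer : Set K) ≠ 0 := by
  apply (IsOpen.measure_pos μ _ ⟨0, zero_mem _⟩).ne'
  exact Valuation.isOpen_integer

/-- The ring of integers is the disjoint union of translates of its maximal ideal `ϖ𝒪`, one for each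
residue class. -/
lemma measure_integer_eq (ϖ : Kˣ) (hϖ : ord (ϖ : K) = 1) :
    μ ((valuation K).integer : Set K) =
      resCard K * μ (ϖ • ((valuation K).integer : Set K)) := by
  set R := (valuation K).integer
  have : Finite (IsLocalRing.ResidueField R) :=
    Nat.finite_of_card_ne_zero (zero_lt_one.trans (one_lt_resCard K)).ne'
  have := Fintype.ofFinite (IsLocalRing.ResidueField R)
  choose r hr using IsLocalRing.residue_surjective (R := R)
  have hmem (x : K) : x ∈ ϖ • (R : Set K) ↔ valuation K x < 1 := by
    rw [Set.mem_smul_set_iff_inv_smul_mem, Units.smul_def, smul_eq_mul, SetLike.mem_coe,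
      Valuation.mem_integer_iff]
    by_cases hx : x = 0
    · simp [hx]
    · have := valuation_le_one_iff (ϖ⁻¹ * Units.mk0 x hx)
      rw [ord_mul, ord_inv, hϖ] at this
      have h2 := valuation_lt_one_iff (Units.mk0 x hx)
      simp only [Units.val_mul, Units.val_mk0] at this h2
      rw [this, h2]
      omega
  have hmax (z : R) : (z : K) ∈ ϖ • (R : Set K) ↔ IsLocalRing.residue R z = 0 := by
    rw [hmem, IsLocalRing.residue_eq_zero_iff, IsLocalRing.mem_maximalIdeal, mem_nonunits_iff,
      Valuation.Integers.isUnit_iff_valuation_eq_one (Valuation.integer.integers (valuation K))]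
    exact ⟨fun h => h.ne, fun h => lt_of_le_of_ne z.2 h⟩
  have hU : (R : Set K) = ⋃ a, ((r a : K) +ᵥ (ϖ • (R : Set K))) := by
    ext x
    simp only [Set.mem_iUnion, Set.mem_vadd_set_iff_neg_vadd_mem, vadd_eq_add]
    constructor
    · intro hx
      refine ⟨IsLocalRing.residue R ⟨x, hx⟩, ?_⟩
      have := hmax (-r (IsLocalRing.residue R ⟨x, hx⟩) + ⟨x, hx⟩)
      refine this.2 ?_
      rw [map_add, map_neg, hr, neg_add_cancel]
    · rintro ⟨a, ha⟩
      have h1 := (hmem _).1 ha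
      have := add_mem (r a).2 (show -(r a : K) + x ∈ R from h1.le)
      simpa using this
  have hd : Pairwise (Function.onFun Disjoint fun a => ((r a : K) +ᵥ (ϖ • (R : Set K)))) := by
    intro a b hab
    rw [Function.onFun, Set.disjoint_left]
    intro x hx hx'
    rw [Set.mem_vadd_set_iff_neg_vadd_mem, vadd_eq_add, hmem] at hx hx'
    apply hab
    rw [← hr a, ← hr b, ← sub_eq_zero, ← map_sub, ← hmax, hmem]
    have := (valuation K).map_sub_lt hx' hx
    convert this using 2
    push_cast
    ring
  have hR : MeasurableSet (ϖ • (R : Set K)) :=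
    MeasurableSet.const_smul (Valuation.isOpen_integer (v := valuation K)).measurableSet ϖ
  conv_lhs => rw [hU]
  rw [measure_iUnion hd fun a => hR.const_vadd _, tsum_fintype]
  simp only [measure_vadd, Finset.sum_const, Finset.card_univ, nsmul_eq_mul]
  rw [resCard, Nat.card_eq_fintype_card]

/-- The scaling factor of Haar measure is a homomorphism on `Kˣ`, so it suffices to find it at a
uniformizer, where it is `1/q`, and at units, which preserve the ring of integers. -/
lemma measure_unit_smul (a : Kˣ) (s : Set K) :
    μ (a • s) = ENNReal.ofReal (nabs (a : K)) * μ s := by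
  obtain ⟨ϖ, hϖ⟩ := exists_ord_eq_one K
  have hq : (resCard K : NNReal) ≠ 0 := by
    exact_mod_cast (zero_lt_one.trans (one_lt_resCard K)).ne'
  have h1 : distribHaarChar K ϖ = (resCard K : NNReal)⁻¹ := by
    apply distribHaarChar_eq_of_measure_smul_eq_mul (measure_integer_ne_zero μ)
      (measure_integer_ne_top μ)
    rw [measure_integer_eq μ ϖ hϖ, ← mul_assoc, ENNReal.coe_inv hq, ENNReal.coe_natCast,
      ENNReal.inv_mul_cancel (by exact_mod_cast hq) (ENNReal.natCast_ne_top _), one_mul]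
  have h2 (u : Kˣ) (hu : ord (u : K) = 0) : distribHaarChar K u = 1 := by
    apply distribHaarChar_eq_of_measure_smul_eq_mul (measure_integer_ne_zero μ)
      (measure_integer_ne_top μ)
    rw [smul_integer_of_ord_eq_zero u hu, ENNReal.coe_one, one_mul]
  rw [← distribHaarChar_mul]
  congr 1
  have ha : a = ϖ ^ ord (a : K) * (ϖ ^ (-ord (a : K)) * a) := by
    rw [← mul_assoc, ← zpow_add, add_neg_cancel, zpow_zero, one_mul]
  conv_lhs => rw [ha]
  rw [map_mul, map_zpow, h1, h2 _ (by rw [ord_mul, ord_zpow, hϖ]; ring), mul_one, nabs_unit,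
    zpow_neg, ← inv_zpow, ENNReal.ofReal, Real.toNNReal_of_nonneg (by positivity)]
  congr 1

end LocalField

/-! ### The multiplicative Haar measure and its image under the order -/

section MulHaar

variable {K : Type*} [Field K] [ValuativeRel K] [TopologicalSpace K]
  [IsNonarchimedeanLocalField K] [MeasurableSpace K] [BorelSpace K]
  (μ : Measure K) [μ.IsAddHaarMeasure]

open scoped Pointwise

/-- Scaling by a uniformizer fixes `{0}` but multiplies measures by `1/q ≠ 1`; a finite mass with
this property is zero. The same argument applied to the whole field shows that its nonzero mass is
infinite. -/
instance nullSingletonClass_of_isAddHaarMeasure : NullSingletonClass μ := by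
  have h0 : μ {0} = 0 := by
    obtain ⟨ϖ, hϖ⟩ := exists_ord_eq_one K
    have h := measure_unit_smul μ ϖ {0}
    rw [Set.smul_set_singleton, smul_zero] at h
    by_contra hne
    have hfin : μ {(0 : K)} ≠ ⊤ := isCompact_singleton.measure_lt_top.ne
    have h2 := (ENNReal.mul_eq_right hne hfin).1 h.symm
    rw [ENNReal.ofReal_eq_one, nabs_unit, hϖ, zpow_neg_one, inv_eq_one] at h2
    have := one_lt_resCard K
    rw [Nat.cast_eq_one] at h2
    omega
  refine ⟨fun x => ?_⟩
  have := measure_vadd μ x {(0 : K)}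
  rwa [Set.vadd_set_singleton, vadd_eq_add, add_zero, h0] at this

lemma measure_univ_eq_top : μ Set.univ = ⊤ := by
  obtain ⟨ϖ, hϖ⟩ := exists_ord_eq_one K
  have h := measure_unit_smul μ ϖ Set.univ
  rw [Set.smul_set_univ] at h
  by_contra hfin
  have h2 := (ENNReal.mul_eq_right (NeZero.ne _) hfin).1 h.symm
  rw [ENNReal.ofReal_eq_one, nabs_unit, hϖ, zpow_neg_one, inv_eq_one] at h2
  have := one_lt_resCard K
  rw [Nat.cast_eq_one] at h2
  omega

lemma map_val_mulHaar :
    (mulHaar μ).map Units.val = μ.withDensity fun x => ENNReal.ofReal (nabs x)⁻¹ := by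
  rw [mulHaar, measurableEmbedding_val.map_comap, range_units_val,
    Measure.restrict_eq_self_of_ae_mem]
  exact (withDensity_absolutelyContinuous _ _).ae_le (Measure.ae_ne μ 0)

omit [μ.IsAddHaarMeasure] in
lemma mulHaar_apply {s : Set Kˣ} (hs : MeasurableSet s) :
    mulHaar μ s = ∫⁻ x in Units.val '' s, ENNReal.ofReal (nabs x)⁻¹ ∂μ := by
  rw [mulHaar, measurableEmbedding_val.comap_apply, withDensity_apply]
  exact measurableEmbedding_val.measurableSet_image.2 hs

lemma map_unit_smul (a : Kˣ) : μ = ENNReal.ofReal (nabs (a : K)) • μ.map (a • ·) := by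
  ext s hs
  rw [Measure.smul_apply, Measure.map_apply (measurable_const_smul a) hs, smul_eq_mul,
    ← measure_unit_smul, Set.preimage_smul, smul_inv_smul]

instance : (mulHaar μ).IsMulLeftInvariant where
  map_mul_left_eq_self a := by
    ext s hs
    rw [Measure.map_apply (measurable_const_mul a) hs, mulHaar_apply μ hs,
      mulHaar_apply μ (measurable_const_mul a hs)]
    have him := measurableEmbedding_val.measurableSet_image.2 hs
    have himp := measurableEmbedding_val.measurableSet_image.2 (measurable_const_mul a hs)
    have hm : Measurable fun x : K => ENNReal.ofReal (nabs x)⁻¹ :=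
      (measurable_nabs).inv.ennreal_ofReal
    rw [← lintegral_indicator him, ← lintegral_indicator himp]
    conv_rhs => rw [map_unit_smul μ a]
    rw [lintegral_smul_measure, lintegral_map (hm.indicator him) (measurable_const_smul a),
      smul_eq_mul, ← lintegral_const_mul]
    · refine lintegral_congr fun x => ?_
      have hmem : a • x ∈ Units.val '' s ↔ x ∈ Units.val '' ((fun y => a * y) ⁻¹' s) := by
        constructor
        · rintro ⟨u, hu, hux⟩
          exact ⟨a⁻¹ * u, by simpa using hu, by simp [hux, Units.smul_def]⟩
        · rintro ⟨u, hu, rfl⟩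
          exact ⟨a * u, hu, rfl⟩
      by_cases hx : a • x ∈ Units.val '' s
      · rw [Set.indicator_of_mem hx, Set.indicator_of_mem (hmem.1 hx)]
        obtain ⟨u, -, rfl⟩ := hmem.1 hx
        rw [Units.smul_def, smul_eq_mul, ← Units.val_mul, nabs_mul,
          ← ENNReal.ofReal_mul (nabs_pos a).le, mul_inv, ← mul_assoc,
          mul_inv_cancel₀ (nabs_pos a).ne', one_mul]
      · rw [Set.indicator_of_notMem hx, Set.indicator_of_notMem (mt hmem.2 hx), mul_zero]
    · exact (hm.indicator him).comp (measurable_const_smul a)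

lemma measurableSet_ord_eq (n : ℤ) : MeasurableSet {x : Kˣ | ord (x : K) = n} :=
  measurable_ord (measurableSet_singleton n)

omit [μ.IsAddHaarMeasure] in
lemma mulHaar_ord_eq_zero :
    mulHaar μ {x : Kˣ | ord (x : K) = 0} = μ (Units.val '' {x : Kˣ | ord (x : K) = 0}) := by
  rw [mulHaar_apply μ (measurableSet_ord_eq 0), ← setLIntegral_one]
  refine setLIntegral_congr_fun
    (measurableEmbedding_val.measurableSet_image.2 (measurableSet_ord_eq 0)) ?_
  rintro _ ⟨u, hu, rfl⟩
  have hu' : ord (u : K) = 0 := hu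
  simp [nabs_unit, hu']

lemma mulHaar_ord_eq_zero_ne_top : mulHaar μ {x : Kˣ | ord (x : K) = 0} ≠ ⊤ := by
  rw [mulHaar_ord_eq_zero]
  refine ne_top_of_le_ne_top (measure_integer_ne_top μ) (measure_mono ?_)
  rintro _ ⟨u, hu, rfl⟩
  exact ((valuation_eq_one_iff u).2 hu).le

lemma mulHaar_ord_eq (n : ℤ) :
    mulHaar μ {x : Kˣ | ord (x : K) = n} = mulHaar μ {x : Kˣ | ord (x : K) = 0} := by
  obtain ⟨ϖ, hϖ⟩ := exists_ord_eq_one K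
  rw [← measure_preimage_mul (mulHaar μ) (ϖ ^ n) {x : Kˣ | ord (x : K) = n}]
  congr 1
  ext x
  rw [Set.mem_preimage, Set.mem_ofPred_eq, Set.mem_ofPred_eq, ord_mul, ord_zpow, hϖ]
  omega

/-- The shells of constant order are translates of one another, so they have equal mass. Integrals
of functions of the order thus become sums over `ℤ`. -/
lemma map_ord_mulHaar : (mulHaar μ).map (fun x : Kˣ => ord (x : K)) =
    mulHaar μ {x : Kˣ | ord (x : K) = 0} • Measure.count := by
  refine Measure.ext_of_singleton fun n => ?_
  rw [Measure.map_apply measurable_ord (measurableSet_singleton n), Measure.smul_apply,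
    Measure.count_singleton, smul_eq_mul, mul_one]
  exact mulHaar_ord_eq μ n

instance : SigmaFinite (mulHaar μ) := by
  have h : SigmaFinite ((mulHaar μ).map (fun x : Kˣ => ord (x : K))) := by
    rw [map_ord_mulHaar, ← ENNReal.coe_toNNReal (mulHaar_ord_eq_zero_ne_top μ)]
    exact SMul.sigmaFinite _
  exact SigmaFinite.of_map _ measurable_ord.aemeasurable h

lemma integrable_map_ord {f : ℤ → ℂ} (hf : Summable f) :
    Integrable f ((mulHaar μ).map (fun x : Kˣ => ord (x : K))) := by
  rw [map_ord_mulHaar]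
  exact (integrable_count_iff.2 hf.norm).smul_measure (mulHaar_ord_eq_zero_ne_top μ)

lemma integrable_comp_ord {f : ℤ → ℂ} (hf : Summable f) :
    Integrable (fun x : Kˣ => f (ord (x : K))) (mulHaar μ) :=
  (integrable_map_ord μ hf).comp_measurable measurable_ord

lemma integral_comp_ord {f : ℤ → ℂ} (hf : Summable f) :
    ∫ x : Kˣ, f (ord (x : K)) ∂(mulHaar μ) =
      (mulHaar μ).real {x : Kˣ | ord (x : K) = 0} * ∑' n, f n := by
  have h := integrable_map_ord μ hf
  rw [← integral_map measurable_ord.aemeasurable h.aestronglyMeasurable, integral_countable h,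
    ← tsum_mul_left]
  congr 1
  ext n
  rw [map_ord_mulHaar, measureReal_def, Measure.smul_apply, Measure.count_singleton, smul_eq_mul,
    mul_one, Complex.real_smul, measureReal_def]

end MulHaar

/-- Two geometric series, over `n ≥ 0` and `n < 0`; this is the source of the factor `(1 +
q^(-s-c))/(1 - q^(-s-c))`. -/
lemma hasSum_pow_natAbs {Q : ℂ} (hQ : ‖Q‖ < 1) :
    HasSum (fun n : ℤ => Q ^ n.natAbs) ((1 + Q) / (1 - Q)) := by
  have h0 := hasSum_geometric_of_norm_lt_one hQ
  have h1 : HasSum (fun n : ℕ => Q ^ (n : ℤ).natAbs) (1 - Q)⁻¹ := h0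
  have h2 : HasSum (fun n : ℕ => Q ^ (-((n : ℤ) + 1)).natAbs) (Q * (1 - Q)⁻¹) := by
    have h3 (n : ℕ) : Q ^ (-((n : ℤ) + 1)).natAbs = Q * Q ^ n := by
      rw [← pow_succ']
      congr 1
    simp_rw [h3]
    exact h0.mul_left Q
  have h4 : (1 + Q) / (1 - Q) = (1 - Q)⁻¹ + Q * (1 - Q)⁻¹ := by ring
  rw [h4]
  exact HasSum.of_nat_of_neg_add_one (f := fun n : ℤ => Q ^ n.natAbs) h1 h2

/-! ### Factorisation of the double integral by a shear -/

section Double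

variable {K : Type*} [Field K] [ValuativeRel K] [TopologicalSpace K]
  [IsNonarchimedeanLocalField K] [MeasurableSpace K] [BorelSpace K]

/-- The shear `(y, z) ↦ (ϖ^n z, ϖ^n z y)` of `Kˣ × Kˣ`, where `n = max (-ord y) 0`. -/
def ordShear (ϖ : Kˣ) : Kˣ × Kˣ ≃ᵐ Kˣ × Kˣ where
  toFun p := (ϖ ^ max (-ord (p.1 : K)) 0 * p.2, ϖ ^ max (-ord (p.1 : K)) 0 * p.2 * p.1)
  invFun p := (p.1⁻¹ * p.2, (ϖ ^ max (-ord ((p.1⁻¹ * p.2 : Kˣ) : K)) 0)⁻¹ * p.1)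
  left_inv p := by
    have : (ϖ ^ max (-ord (p.1 : K)) 0 * p.2)⁻¹ *
      (ϖ ^ max (-ord (p.1 : K)) 0 * p.2 * p.1) = p.1 := by rw [inv_mul_cancel_left]
    ext1
    · exact this
    · simp only [this, inv_mul_cancel_left]
  right_inv p := by
    ext1
    · simp only [mul_inv_cancel_left]
    · simp only [mul_inv_cancel_left]
  measurable_toFun := by
    have h : Measurable fun y : Kˣ => ϖ ^ max (-ord (y : K)) 0 :=
      (measurable_of_countable (fun n : ℤ => ϖ ^ max (-n) 0)).comp measurable_ord
    have h2 : Measurable fun p : Kˣ × Kˣ => ϖ ^ max (-ord (p.1 : K)) 0 * p.2 :=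
      (h.comp measurable_fst).mul measurable_snd
    exact h2.prodMk (h2.mul measurable_fst)
  measurable_invFun := by
    have h : Measurable fun y : Kˣ => ϖ ^ max (-ord (y : K)) 0 :=
      (measurable_of_countable (fun n : ℤ => ϖ ^ max (-n) 0)).comp measurable_ord
    have h2 : Measurable fun p : Kˣ × Kˣ => p.1⁻¹ * p.2 := by fun_prop
    have h3 := h.comp h2
    exact h2.prodMk (h3.inv.mul measurable_fst)

variable (μ : Measure K) [μ.IsAddHaarMeasure]

/-- The shear is a composite of a fibrewise translation by `ϖ^n`, the swap, and `(z, y) ↦ (z, zy)`,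
each preserving the product of invariant measures. -/
lemma measurePreserving_ordShear (ϖ : Kˣ) :
    MeasurePreserving (ordShear ϖ) ((mulHaar μ).prod (mulHaar μ))
      ((mulHaar μ).prod (mulHaar μ)) := by
  have h : Measurable fun y : Kˣ => ϖ ^ max (-ord (y : K)) 0 :=
    (measurable_of_countable (fun n : ℤ => ϖ ^ max (-n) 0)).comp measurable_ord
  have h1 : MeasurePreserving (fun p : Kˣ × Kˣ => (p.1, ϖ ^ max (-ord (p.1 : K)) 0 * p.2))
      ((mulHaar μ).prod (mulHaar μ)) ((mulHaar μ).prod (mulHaar μ)) :=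
    (MeasurePreserving.id _).skew_product (g := fun (y : Kˣ) z => ϖ ^ max (-ord (y : K)) 0 * z)
      ((h.comp measurable_fst).mul measurable_snd)
      (Filter.Eventually.of_forall fun y => map_mul_left_eq_self _ _)
  exact (measurePreserving_prod_mul (mulHaar μ) (mulHaar μ)).comp
    (Measure.measurePreserving_swap.comp h1)

/-- The reduction of the two-dimensional zeta integrand to `Kˣ × Kˣ`. -/
def doubleIntegrand (ϖ : Kˣ) (g : K → ℂ) (ω : Kˣ →ₜ* ℂˣ) (s : ℂ) (p : Kˣ × Kˣ) : ℂ :=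
  g ((ϖ ^ (min (ord (p.1 : K)) (ord (p.2 : K)) - ord (p.1 : K)) * p.1 : Kˣ) : K) *
    ((ω (ϖ ^ ord (p.2 : K) * p.1) : ℂ) *
      (nabs ((ϖ ^ ord (p.2 : K) * p.1 : Kˣ) : K) : ℂ) ^ s)

/-- The integrand over `Kˣ` to which the double integral reduces. -/
def singleIntegrand (ϖ : Kˣ) (g : K → ℂ) (ω : Kˣ →ₜ* ℂˣ) (s : ℂ) (z : Kˣ) : ℂ :=
  g z * ((ω z : ℂ) * (ω ϖ : ℂ) ^ ord (z : K)) * ((resCard K : ℂ) ^ (-s)) ^ (2 * ord (z : K))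

omit [MeasurableSpace K] [BorelSpace K] in
variable (K) in
lemma resCard_cpow_ne_zero (s : ℂ) : (resCard K : ℂ) ^ s ≠ 0 := by
  have := (zero_lt_one.trans (one_lt_resCard K)).ne'
  simp [Complex.cpow_eq_zero_iff, this]

/-- The new coordinates have orders `m + ord z` and `m + ord z + ord y` with `m = max (-ord y) 0`.
Their minimum is `ord z`, so the argument of `g` is exactly `z`, and `y` enters only through a power
of `Q`. -/
lemma doubleIntegrand_ordShear {ϖ : Kˣ} (hϖ : ord (ϖ : K) = 1) (g : K → ℂ) (ω : Kˣ →ₜ* ℂˣ)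
    (s : ℂ) (p : Kˣ × Kˣ) :
    doubleIntegrand ϖ g ω s (ordShear ϖ p) =
      ((ω ϖ : ℂ) * (resCard K : ℂ) ^ (-s)) ^ (ord (p.1 : K)).natAbs *
        singleIntegrand ϖ g ω s p.2 := by
  obtain ⟨y, z⟩ := p
  set m := max (-ord (y : K)) 0 with hm
  have e1 : (ordShear ϖ (y, z)).1 = ϖ ^ m * z := rfl
  have e2 : (ordShear ϖ (y, z)).2 = ϖ ^ m * z * y := rfl
  have hQ := resCard_cpow_ne_zero K (-s)
  have hw : (ω ϖ : ℂ) ≠ 0 := (ω ϖ).ne_zero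
  have o1 : ord ((ϖ ^ m * z : Kˣ) : K) = m + ord (z : K) := by
    rw [ord_mul, ord_zpow, hϖ, mul_one]
  have o2 : ord ((ϖ ^ m * z * y : Kˣ) : K) = m + ord (z : K) + ord (y : K) := by
    rw [ord_mul, o1]
  rw [doubleIntegrand, e1, e2, o1, o2, singleIntegrand, nabs_cpow]
  have hmin : min (m + ord (z : K)) (m + ord (z : K) + ord (y : K)) - (m + ord (z : K)) = -m := by
    omega
  have hz : ϖ ^ (-m) * (ϖ ^ m * z) = z := by rw [zpow_neg, inv_mul_cancel_left]
  -- One `m` comes from the first coordinate and `m + ord y` from the second; `2 max(-k, 0) + k =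
  -- |k|`.
  have habs : ((ord (y : K)).natAbs : ℤ) = m + ord (y : K) + m := by omega
  rw [hmin, hz, map_mul, map_mul, map_zpow, map_zpow, ord_mul, o1, ord_zpow, hϖ, mul_one,
    ← zpow_natCast, mul_zpow, habs, Units.val_mul, Units.val_mul, Units.val_zpow_eq_zpow_val,
    Units.val_zpow_eq_zpow_val]
  simp only [zpow_add₀ hQ, zpow_add₀ hw, two_mul]
  ring

theorem integrable_doubleIntegrand {ϖ : Kˣ} (hϖ : ord (ϖ : K) = 1) {g : K → ℂ}
    {ω : Kˣ →ₜ* ℂˣ} {s : ℂ} (hQ : ‖(ω ϖ : ℂ) * (resCard K : ℂ) ^ (-s)‖ < 1)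
    (h : Integrable (singleIntegrand ϖ g ω s) (mulHaar μ)) :
    Integrable (doubleIntegrand ϖ g ω s) ((mulHaar μ).prod (mulHaar μ)) := by
  rw [← (measurePreserving_ordShear μ ϖ).integrable_comp_emb (ordShear ϖ).measurableEmbedding]
  refine (((integrable_comp_ord μ (hasSum_pow_natAbs hQ).summable).mul_prod h).congr
    (Filter.Eventually.of_forall fun p => ?_))
  exact (doubleIntegrand_ordShear hϖ g ω s p).symm

theorem integral_doubleIntegrand {ϖ : Kˣ} (hϖ : ord (ϖ : K) = 1) {g : K → ℂ}
    {ω : Kˣ →ₜ* ℂˣ} {s : ℂ} (hQ : ‖(ω ϖ : ℂ) * (resCard K : ℂ) ^ (-s)‖ < 1) :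
    ∫ p, doubleIntegrand ϖ g ω s p ∂((mulHaar μ).prod (mulHaar μ)) =
      (mulHaar μ).real {x : Kˣ | ord (x : K) = 0} *
        ((1 + (ω ϖ : ℂ) * (resCard K : ℂ) ^ (-s)) / (1 - (ω ϖ : ℂ) * (resCard K : ℂ) ^ (-s))) *
        ∫ z, singleIntegrand ϖ g ω s z ∂(mulHaar μ) := by
  rw [← (measurePreserving_ordShear μ ϖ).integral_comp (ordShear ϖ).measurableEmbedding]
  simp_rw [doubleIntegrand_ordShear hϖ]
  rw [integral_prod_mul (fun y : Kˣ => ((ω ϖ : ℂ) * (resCard K : ℂ) ^ (-s)) ^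
    (ord (y : K)).natAbs) (singleIntegrand ϖ g ω s),
    integral_comp_ord μ (hasSum_pow_natAbs hQ).summable, (hasSum_pow_natAbs hQ).tsum_eq]

end Double

/-! ### Passage from `Kˣ × Kˣ` to `K × K` -/

section AdditiveForm

variable {K : Type*} [Field K] [ValuativeRel K] [TopologicalSpace K]
  [IsNonarchimedeanLocalField K]

/-- The function `G(x, y) |x|⁻¹ |y|⁻¹` on `K × K` (zero on the axes) attached to a function `G` on
`Kˣ × Kˣ`. -/
def additiveForm (G : Kˣ × Kˣ → ℂ) (p : K × K) : ℂ :=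
  (((nabs p.1)⁻¹ * (nabs p.2)⁻¹ : ℝ) : ℂ) *
    Function.extend (Prod.map Units.val Units.val) G 0 p

lemma additiveForm_units (G : Kˣ × Kˣ → ℂ) (x y : Kˣ) :
    additiveForm G (x, y) = (((nabs (x : K))⁻¹ * (nabs (y : K))⁻¹ : ℝ) : ℂ) * G (x, y) := by
  rw [additiveForm]
  congr 1
  exact (Units.val_injective.prodMap Units.val_injective).extend_apply G 0 (x, y)

/-- Rests on the default values `nabs 0 = 0` and `0⁻¹ = 0`. It makes the lift vanish at points of
`𝒪_F × 𝒪_F` outside `T`. -/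
lemma additiveForm_of_eq_zero (G : Kˣ × Kˣ → ℂ) {p : K × K} (hp : p.1 = 0 ∨ p.2 = 0) :
    additiveForm G p = 0 := by
  rcases hp with hp | hp <;> simp [additiveForm, hp, nabs]

variable [MeasurableSpace K] [BorelSpace K] (μ : Measure K) [μ.IsAddHaarMeasure]

lemma map_val_prod_mulHaar :
    ((mulHaar μ).prod (mulHaar μ)).map (Prod.map Units.val Units.val) =
      (μ.prod μ).withDensity fun p => ENNReal.ofReal ((nabs p.1)⁻¹ * (nabs p.2)⁻¹) := by
  have hm : Measurable fun x : K => ENNReal.ofReal (nabs x)⁻¹ :=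
    (measurable_nabs).inv.ennreal_ofReal
  rw [← Measure.map_prod_map _ _ measurableEmbedding_val.measurable
    measurableEmbedding_val.measurable, map_val_mulHaar, prod_withDensity hm hm]
  congr 1
  ext p
  rw [ENNReal.ofReal_mul]
  rw [nabs]
  split_ifs <;> positivity

lemma integrable_additiveForm {G : Kˣ × Kˣ → ℂ}
    (hG : Integrable G ((mulHaar μ).prod (mulHaar μ))) :
    Integrable (additiveForm G) (μ.prod μ) ∧
      ∫ p, additiveForm G p ∂(μ.prod μ) = ∫ p, G p ∂((mulHaar μ).prod (mulHaar μ)) := by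
  have he : MeasurableEmbedding (Prod.map Units.val Units.val : Kˣ × Kˣ → K × K) :=
    measurableEmbedding_val.prodMap measurableEmbedding_val
  have hcomp : Function.extend (Prod.map Units.val Units.val) G 0 ∘
      (Prod.map Units.val Units.val : Kˣ × Kˣ → K × K) = G :=
    Function.extend_comp he.injective G 0
  have hm : Measurable fun p : K × K =>
      ENNReal.ofReal ((nabs p.1)⁻¹ * (nabs p.2)⁻¹) := by
    have := measurable_nabs (K := K)
    fun_prop
  have hfin : ∀ᵐ p ∂(μ.prod μ), ENNReal.ofReal ((nabs p.1)⁻¹ * (nabs p.2)⁻¹) < ⊤ :=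
    Filter.Eventually.of_forall fun _ => ENNReal.ofReal_lt_top
  have hform : additiveForm G = fun p : K × K =>
      (ENNReal.ofReal ((nabs p.1)⁻¹ * (nabs p.2)⁻¹)).toReal •
        Function.extend (Prod.map Units.val Units.val) G 0 p := by
    ext p
    rw [additiveForm, ENNReal.toReal_ofReal, Complex.real_smul]
    rw [nabs, nabs]
    split_ifs <;> positivity
  constructor
  · rw [hform, ← integrable_withDensity_iff_integrable_smul' hm hfin, ← map_val_prod_mulHaar,
      he.integrable_map_iff, hcomp]
    exact hG
  · rw [hform, ← integral_withDensity_eq_integral_toReal_smul hm hfin, ← map_val_prod_mulHaar,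
      he.integral_map]
    exact integral_congr_ae (Filter.Eventually.of_forall fun p => congrFun hcomp p)

end AdditiveForm

/-! ### The two-dimensional integrand as a single lift -/

section Existence

variable {F K : Type*} [Field F] [Valued F ℤᵐ⁰] [Field K] [ValuativeRel K] [TopologicalSpace K]
  [IsNonarchimedeanLocalField K] (D : LocalParams F K)

lemma val_eq_one_of_nu {x : Fˣ} (h : nu x = 0) : (Valued.v (x : F) : ℤᵐ⁰) = 1 := by
  rw [val_eq_exp, h, neg_zero, WithZero.exp_zero]

namespace LocalParams

lemma nu_t₁ : nu D.t₁ = 0 := nu_eq_of_val (by rw [D.val_t₁]; simp)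

lemma nu_t₂ : nu D.t₂ = 1 := nu_eq_of_val D.val_t₂

lemma nu_t₁_zpow (n : ℤ) : nu (D.t₁ ^ n) = 0 :=
  nu_eq_of_val (by rw [Units.val_zpow_eq_zpow_val, map_zpow₀, D.val_t₁]; simp)

lemma ord_prime : ord (D.prime : K) = 1 := by
  rw [prime, D.eta_of_nu_zero D.nu_t₁, D.resExt_of_le D.val_t₁.le, D.ord_res_t₁]

/-- With `i`, `j` the orders of the residues, `{t₁, t₂}` contributes `π^(i+j)` and `{u, t₂}`
contributes `η(x) π^(-i)`, while `{t₁, v}` has trivial tame symbol because both entries are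
`ν`-units. -/
lemma border_tmap {x y : Fˣ} (hx : nu x = 0) (hy : nu y = 0) :
    (D.border (D.tmap x y)).toMul = D.prime ^ ord (D.eta y : K) * D.eta x := by
  have h1 : D.tame D.t₁ D.t₂ = D.prime := by
    simp [tame, nu_t₁, nu_t₂, prime]
  have h2 : D.tame (x * D.t₁ ^ (-ord (D.eta x : K))) D.t₂ =
      D.eta x * D.prime ^ (-ord (D.eta x : K)) := by
    rw [tame, nu_mul, hx, nu_t₁_zpow, nu_t₂]
    simp [prime]
  have h3 : D.tame D.t₁ (y * D.t₁ ^ (-ord (D.eta y : K))) = 1 := by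
    rw [tame, nu_mul, hy, nu_t₁_zpow, nu_t₁]
    simp
  rw [tmap, map_add D.border, map_add D.border, map_zsmul D.border, border_symb, border_symb,
    border_symb, h1, h2, h3,
    toMul_add, toMul_add, toMul_zsmul, toMul_ofMul, toMul_ofMul, toMul_ofMul, mul_one, zpow_add,
    zpow_neg]
  rw [mul_comm (D.prime ^ _) (D.prime ^ _), mul_comm (D.eta x), mul_assoc, mul_inv_cancel_left]

lemma rho2_of_nu_eq_zero {x y : Fˣ} (hx : nu x = 0) (hy : nu y = 0) :
    D.rho2 (x, y) = ((D.prime ^ (min (ord (D.eta x : K)) (ord (D.eta y : K)) -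
      ord (D.eta x : K)) * D.eta x : Kˣ) : K) := by
  simp only [rho2, hx, hy, min_self, neg_zero, zpow_zero, mul_one]
  rw [← D.eta_of_nu_zero (by rw [nu_mul, nu_mul, D.nu_t₁_zpow, D.nu_t₁_zpow, hx]; rfl), map_mul,
    map_mul, map_zpow, map_zpow, sub_eq_add_neg, zpow_add, prime]
  congr 1
  rw [mul_assoc, mul_comm (D.eta x)]

lemma absF_of_nu_eq_zero {x : Fˣ} (hx : nu x = 0) :
    absF D x = RatFunc.C (nabs (D.eta x : K) : ℂ) := by
  rw [absF, hx, zpow_zero, mul_one]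

variable [MeasurableSpace K] [BorelSpace K] (μ : Measure K) [μ.IsAddHaarMeasure]

theorem hasZetaIntegral_of_integrable {g : K → ℂ} {ω : Kˣ →ₜ* ℂˣ} {s : ℂ}
    (h : Integrable (doubleIntegrand D.prime g ω s) ((mulHaar μ).prod (mulHaar μ))) :
    D.HasZetaIntegral μ (D.compRho g) (D.pullChar ω) s
      (RatFunc.C (∫ p, doubleIntegrand D.prime g ω s p ∂((mulHaar μ).prod (mulHaar μ)))) := by
  obtain ⟨h1, h2⟩ := integrable_additiveForm μ h
  refine ⟨fun x => RatFunc.C (D.lift (additiveForm (doubleIntegrand D.prime g ω s)) 0 0 x),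
    fun x y => ?_, Submodule.subset_span ⟨_, 0, 0, h1, ?_⟩⟩
  · beta_reduce
    have hlift : D.lift (additiveForm (doubleIntegrand D.prime g ω s)) 0 0 ((x : F), (y : F)) =
        if (Valued.v (x : F) : ℤᵐ⁰) ≤ 1 ∧ (Valued.v (y : F) : ℤᵐ⁰) ≤ 1 then
          additiveForm (doubleIntegrand D.prime g ω s) (D.resExt x, D.resExt y) else 0 := by
      simp [lift]
    rw [hlift, zetaIntegrand]
    by_cases hnu : nu x = 0 ∧ nu y = 0
    · obtain ⟨hx, hy⟩ := hnu
      rw [if_pos ⟨(val_eq_one_of_nu hx).le, (val_eq_one_of_nu hy).le⟩,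
        if_pos (show nu (x, y).1 = 0 ∧ nu (x, y).2 = 0 from ⟨hx, hy⟩),
        ← D.eta_of_nu_zero hx, ← D.eta_of_nu_zero hy, additiveForm_units,
        D.absF_of_nu_eq_zero hx, D.absF_of_nu_eq_zero hy, ← map_inv₀, ← map_inv₀, compRho,
        ← map_mul, ← map_mul, ← map_mul, D.rho2_of_nu_eq_zero hx hy, absK2,
        D.border_tmap hx hy, doubleIntegrand]
      have hchi : ((D.pullChar ω (D.tmap x y)).toMul : ℂ) =
          ω (D.prime ^ ord (D.eta y : K) * D.eta x) := by
        rw [← D.border_tmap hx hy]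
        rfl
      rw [hchi]
      congr 1
      push_cast
      ring
    · rw [if_neg hnu, zero_mul, zero_mul]
      split_ifs with hv
      -- An integral point outside `T` has a coordinate of positive valuation, hence residue zero,
      -- where `additiveForm` vanishes; this agrees with the factor `char_T`.
      · have hlt (z : Fˣ) (hz : (Valued.v (z : F) : ℤᵐ⁰) ≤ 1) (hz0 : nu z ≠ 0) :
            D.resExt z = 0 := by
          apply D.resExt_of_lt (lt_of_le_of_ne hz fun he => hz0 (nu_eq_of_val ?_))
          rw [he, neg_zero, WithZero.exp_zero]
        rw [additiveForm_of_eq_zero, map_zero]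
        rw [not_and_or] at hnu
        exact hnu.imp (hlt x hv.1) (hlt y hv.2)
      · exact map_zero _
  · rw [h2]
    simp

end LocalParams

end Existence

/-- Almost every slice `h(u, ·)` differs from a fixed one by a constant, and an integrable constant
on a space of infinite measure is zero. So the slice integral is almost everywhere independent of
`u`, and being integrable in `u` it is zero too. Working with slices avoids measurability of `h₁`
and `h₂`. -/
lemma integral_prod_eq_zero_of_ae_eq_add {α : Type*} [MeasurableSpace α] {μ : Measure α}
    [SigmaFinite μ] (hμ : μ Set.univ = ⊤) {h : α × α → ℂ} (hint : Integrable h (μ.prod μ))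
    {h₁ h₂ : α → ℂ} (hae : ∀ᵐ p ∂(μ.prod μ), h p = h₁ p.1 + h₂ p.2) :
    ∫ p, h p ∂(μ.prod μ) = 0 := by
  have hconst (c : ℂ) (hc : Integrable (fun _ => c) μ) : c = 0 := by
    rcases integrable_const_iff.1 hc with h0 | h0
    · exact h0
    · exact absurd hμ (measure_ne_top μ _)
  have hne : (ae μ).NeBot := by
    rw [ae_neBot]
    rintro rfl
    simp at hμ
  have hslice := (Measure.ae_ae_of_ae_prod hae).and hint.prod_right_ae
  obtain ⟨u₀, h0, hi0⟩ := hslice.exists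
  have hH : ∀ᵐ u ∂μ, (fun v => h (u, v)) =ᵐ[μ] fun v => h (u₀, v) := by
    filter_upwards [hslice] with u hu
    have h3 : (fun v => h (u, v) - h (u₀, v)) =ᵐ[μ] fun _ => h₁ u - h₁ u₀ := by
      filter_upwards [hu.1, h0] with v hv hv0
      rw [hv, hv0]
      ring
    have h4 := hconst _ ((hu.2.sub hi0).congr h3)
    rw [h4] at h3
    filter_upwards [h3] with v hv
    exact sub_eq_zero.1 hv
  have hI : (fun u => ∫ v, h (u, v) ∂μ) =ᵐ[μ] fun _ => ∫ v, h (u₀, v) ∂μ := by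
    filter_upwards [hH] with u hu
    exact integral_congr_ae hu
  have h5 := hconst _ (hint.integral_prod_left.congr hI)
  rw [integral_prod _ hint, integral_congr_ae hI, h5, integral_zero]

/-! ### Uniqueness of the integral on `F × F` -/

section Uniqueness

variable {F K : Type*} [Field F] [Valued F ℤᵐ⁰] [Field K] [ValuativeRel K] [TopologicalSpace K]
  [IsNonarchimedeanLocalField K] (D : LocalParams F K)

namespace LocalParams

/-- A set-theoretic section of the residue map. -/
def sec (u : K) : F := (Function.surjInv D.res_surjective u : Valued.integer F)

lemma val_sec (u : K) : (Valued.v (D.sec u) : ℤᵐ⁰) ≤ 1 :=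
  (Function.surjInv D.res_surjective u).2

lemma resExt_sec (u : K) : D.resExt (D.sec u) = u := by
  rw [D.resExt_of_le (D.val_sec u)]
  exact Function.surjInv_eq D.res_surjective u

/-- The point of the coset `a + t₂^γ 𝒪_F` with coordinate `u`. -/
def cosetPoint (a : F) (γ : ℤ) (u : K) : F := a + D.sec u * ((D.t₂ ^ γ : Fˣ) : F)

/-- The coordinate of a point on the coset `b + t₂^δ 𝒪_F`. -/
def cosetCoord (b : F) (δ : ℤ) (x : F) : F := (x - b) * ((D.t₂ ^ (-δ) : Fˣ) : F)

lemma cosetCoord_cosetPoint (a b : F) (γ δ : ℤ) (u : K) :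
    D.cosetCoord b δ (D.cosetPoint a γ u) =
      D.cosetCoord b δ a + D.sec u * ((D.t₂ ^ (γ - δ) : Fˣ) : F) := by
  rw [cosetCoord, cosetPoint, cosetCoord, sub_eq_add_neg γ, zpow_add, Units.val_mul]
  ring

/-- Two pairs define the same coset `a + t₂^γ 𝒪_F`. -/
def SameCoset (p p' : F × ℤ) : Prop :=
  p.2 = p'.2 ∧ (Valued.v (D.cosetCoord p.1 p.2 p'.1) : ℤᵐ⁰) ≤ 1

lemma sameCoset_equivalence : Equivalence D.SameCoset where
  refl p := ⟨rfl, by simp [cosetCoord]⟩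
  symm {p p'} h := by
    refine ⟨h.1.symm, ?_⟩
    have h2 := h.2
    rw [cosetCoord, map_mul] at h2 ⊢
    rwa [Valuation.map_sub_swap, ← h.1]
  trans {p p' p''} h h' := by
    refine ⟨h.1.trans h'.1, ?_⟩
    have h2 := h'.2
    rw [← h.1] at h2
    have : D.cosetCoord p.1 p.2 p''.1 =
        D.cosetCoord p'.1 p.2 p''.1 + D.cosetCoord p.1 p.2 p'.1 := by
      simp only [cosetCoord]
      ring
    rw [this]
    exact (Valuation.map_add _ _ _).trans (max_le h2 h.2)

lemma cosetCoord_of_sameCoset {a b : F} {γ δ : ℤ} (h : D.SameCoset (b, δ) (a, γ)) (u : K) :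
    (Valued.v (D.cosetCoord b δ (D.cosetPoint a γ u)) : ℤᵐ⁰) ≤ 1 ∧
      D.resExt (D.cosetCoord b δ (D.cosetPoint a γ u)) =
        u + D.resExt (D.cosetCoord b δ a) := by
  obtain ⟨h1, h2⟩ := h
  dsimp only at h1 h2
  subst h1
  have hz : D.cosetCoord b δ (D.cosetPoint a δ u) = D.sec u + D.cosetCoord b δ a := by
    rw [cosetCoord_cosetPoint, sub_self, zpow_zero, Units.val_one, mul_one, add_comm]
  rw [hz, D.resExt_add (D.val_sec u) h2, D.resExt_sec]
  exact ⟨(Valuation.map_add _ _ _).trans (max_le (D.val_sec u) h2), rfl⟩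

lemma val_t₂_zpow_lt_one {n : ℤ} (hn : 0 < n) :
    (Valued.v ((D.t₂ ^ n : Fˣ) : F) : ℤᵐ⁰) < 1 := by
  rw [D.val_t₂_zpow, ← WithZero.exp_zero, WithZero.exp_lt_exp]
  omega

/-- Two cosets are nested or disjoint. If `a + t₂^γ 𝒪_F` is the smaller, it lies in a single residue
class of the other or misses it. Otherwise the other coset meets it in at most one residue class,
which is the excluded coordinate. -/
lemma cosetCoord_of_not_sameCoset {a b : F} {γ δ : ℤ} (h : ¬ D.SameCoset (b, δ) (a, γ)) :
    ∃ E : Set K, E.Finite ∧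
      ((∀ u ∉ E, ¬ (Valued.v (D.cosetCoord b δ (D.cosetPoint a γ u)) : ℤᵐ⁰) ≤ 1) ∨
        ∃ c, ∀ u ∉ E, (Valued.v (D.cosetCoord b δ (D.cosetPoint a γ u)) : ℤᵐ⁰) ≤ 1 ∧
          D.resExt (D.cosetCoord b δ (D.cosetPoint a γ u)) = c) := by
  rcases lt_or_ge δ γ with hlt | hge
  · refine ⟨∅, Set.finite_empty, ?_⟩
    have hsmall (u : K) : (Valued.v (D.sec u * ((D.t₂ ^ (γ - δ) : Fˣ) : F)) : ℤᵐ⁰) < 1 := by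
      rw [mul_comm, map_mul]
      exact mul_lt_one_of_lt_of_le (D.val_t₂_zpow_lt_one (by omega)) (D.val_sec u)
    by_cases hw : (Valued.v (D.cosetCoord b δ a) : ℤᵐ⁰) ≤ 1
    · refine Or.inr ⟨D.resExt (D.cosetCoord b δ a), fun u _ => ?_⟩
      rw [cosetCoord_cosetPoint, D.resExt_add hw (hsmall u).le, D.resExt_of_lt (hsmall u),
        add_zero]
      exact ⟨(Valuation.map_add _ _ _).trans (max_le hw (hsmall u).le), rfl⟩
    · refine Or.inl fun u _ hu => hw ?_
      rw [cosetCoord_cosetPoint] at hu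
      have := (Valuation.map_sub _ _ _).trans (max_le hu (hsmall u).le)
      rwa [add_sub_cancel_right] at this
  · refine ⟨{-D.resExt (D.cosetCoord b γ a)}, Set.finite_singleton _, Or.inl fun u hu hv => ?_⟩
    have hn : D.cosetCoord b δ (D.cosetPoint a γ u) * ((D.t₂ ^ (δ - γ) : Fˣ) : F) =
        D.cosetCoord b γ a + D.sec u := by
      rw [cosetCoord_cosetPoint, add_mul, mul_assoc, ← Units.val_mul, ← zpow_add,
        sub_add_sub_cancel', sub_self, zpow_zero, Units.val_one, mul_one, cosetCoord, cosetCoord,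
        mul_assoc, ← Units.val_mul, ← zpow_add]
      congr 5
      ring
    have hle : (Valued.v ((D.t₂ ^ (δ - γ) : Fˣ) : F) : ℤᵐ⁰) ≤ 1 := by
      rw [D.val_t₂_zpow, ← WithZero.exp_zero, WithZero.exp_le_exp]
      omega
    have hn1 : (Valued.v (D.cosetCoord b γ a + D.sec u) : ℤᵐ⁰) ≤ 1 := by
      rw [← hn, map_mul]
      exact mul_le_one' hv hle
    have hw : (Valued.v (D.cosetCoord b γ a) : ℤᵐ⁰) ≤ 1 := by
      have := (Valuation.map_sub _ _ _).trans (max_le hn1 (D.val_sec u))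
      rwa [add_sub_cancel_right] at this
    rcases hge.eq_or_lt with heq | hgt
    · subst heq
      exact h ⟨rfl, hw⟩
    · have hn2 : (Valued.v (D.cosetCoord b γ a + D.sec u) : ℤᵐ⁰) < 1 := by
        rw [← hn, mul_comm, map_mul]
        exact mul_lt_one_of_lt_of_le (D.val_t₂_zpow_lt_one (by omega)) hv
      have h3 := D.resExt_of_lt hn2
      rw [D.resExt_add hw (D.val_sec u), D.resExt_sec] at h3
      exact hu (neg_eq_of_add_eq_zero_right h3).symm

/-- Only one residue class of the coset can contain `0`. This allows relations known only off the
axes to be evaluated at almost all coordinates. -/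
lemma cosetPoint_ne_zero (a : F) (γ : ℤ) :
    ∃ E : Set K, E.Finite ∧ ∀ u ∉ E, D.cosetPoint a γ u ≠ 0 := by
  refine ⟨{D.resExt (-a * ((D.t₂ ^ (-γ) : Fˣ) : F))}, Set.finite_singleton _, fun u hu h0 => ?_⟩
  have : D.sec u = -a * ((D.t₂ ^ (-γ) : Fˣ) : F) := by
    rw [zpow_neg, Units.eq_mul_inv_iff_mul_eq]
    exact (neg_eq_of_add_eq_zero_right h0).symm
  rw [← this, D.resExt_sec] at hu
  exact hu rfl

lemma lift_eq (g : K × K → ℂ) (a : F × F) (γ : ℤ × ℤ) (x y : F) [Decidable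
    ((Valued.v (D.cosetCoord a.1 γ.1 x) : ℤᵐ⁰) ≤ 1 ∧
      (Valued.v (D.cosetCoord a.2 γ.2 y) : ℤᵐ⁰) ≤ 1)] :
    D.lift g a γ (x, y) = if (Valued.v (D.cosetCoord a.1 γ.1 x) : ℤᵐ⁰) ≤ 1 ∧
      (Valued.v (D.cosetCoord a.2 γ.2 y) : ℤᵐ⁰) ≤ 1 then
        g (D.resExt (D.cosetCoord a.1 γ.1 x), D.resExt (D.cosetCoord a.2 γ.2 y)) else 0 := by
  rw [lift]
  simp only [cosetCoord]
  congr

/-- Two data `(a, γ)` define the same product of cosets. -/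
def SameRect (p p' : (F × F) × (ℤ × ℤ)) : Prop :=
  D.SameCoset (p.1.1, p.2.1) (p'.1.1, p'.2.1) ∧ D.SameCoset (p.1.2, p.2.2) (p'.1.2, p'.2.2)

lemma sameRect_equivalence : Equivalence D.SameRect where
  refl _ := ⟨D.sameCoset_equivalence.refl _, D.sameCoset_equivalence.refl _⟩
  symm h := ⟨D.sameCoset_equivalence.symm h.1, D.sameCoset_equivalence.symm h.2⟩
  trans h h' := ⟨D.sameCoset_equivalence.trans h.1 h'.1, D.sameCoset_equivalence.trans h.2 h'.2⟩

lemma lift_of_sameRect (g : K × K → ℂ) {a b : F × F} {γ δ : ℤ × ℤ}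
    (h : D.SameRect (b, δ) (a, γ)) (u v : K) :
    D.lift g b δ (D.cosetPoint a.1 γ.1 u, D.cosetPoint a.2 γ.2 v) =
      g (u + D.resExt (D.cosetCoord b.1 δ.1 a.1), v + D.resExt (D.cosetCoord b.2 δ.2 a.2)) := by
  classical
  obtain ⟨h1, h2⟩ := D.cosetCoord_of_sameCoset h.1 u
  obtain ⟨h3, h4⟩ := D.cosetCoord_of_sameCoset h.2 v
  rw [lift_eq, if_pos ⟨h1, h3⟩, h2, h4]

/-- At least one side differs. In that direction the lift is, off a finite set, zero or independent
of the coordinate, so at most one variable survives. -/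
lemma lift_of_not_sameRect (g : K × K → ℂ) {a b : F × F} {γ δ : ℤ × ℤ}
    (h : ¬ D.SameRect (b, δ) (a, γ)) :
    ∃ (E : Set K) (h₁ h₂ : K → ℂ), E.Finite ∧ ∀ u ∉ E, ∀ v ∉ E,
      D.lift g b δ (D.cosetPoint a.1 γ.1 u, D.cosetPoint a.2 γ.2 v) = h₁ u + h₂ v := by
  classical
  simp only [lift_eq]
  by_cases h1 : D.SameCoset (b.1, δ.1) (a.1, γ.1)
  · obtain ⟨E, hE, h2 | ⟨c, h2⟩⟩ := D.cosetCoord_of_not_sameCoset fun h2 => h ⟨h1, h2⟩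
    · exact ⟨E, 0, 0, hE, fun u _ v hv => by simp [h2 v hv]⟩
    · refine ⟨E, fun u => g (u + D.resExt (D.cosetCoord b.1 δ.1 a.1), c), 0, hE,
        fun u _ v hv => ?_⟩
      obtain ⟨h3, h4⟩ := D.cosetCoord_of_sameCoset h1 u
      rw [if_pos ⟨h3, (h2 v hv).1⟩, (h2 v hv).2, h4, Pi.zero_apply, add_zero]
  · obtain ⟨E, hE, h2 | ⟨c, h2⟩⟩ := D.cosetCoord_of_not_sameCoset h1
    · exact ⟨E, 0, 0, hE, fun u hu v _ => by simp [h2 u hu]⟩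
    · by_cases h1' : D.SameCoset (b.2, δ.2) (a.2, γ.2)
      · refine ⟨E, 0, fun v => g (c, v + D.resExt (D.cosetCoord b.2 δ.2 a.2)), hE,
          fun u hu v _ => ?_⟩
        obtain ⟨h3, h4⟩ := D.cosetCoord_of_sameCoset h1' v
        rw [if_pos ⟨(h2 u hu).1, h3⟩, (h2 u hu).2, h4, Pi.zero_apply, zero_add]
      · obtain ⟨E', hE', h2' | ⟨c', h2'⟩⟩ := D.cosetCoord_of_not_sameCoset h1'
        · refine ⟨E', 0, 0, hE', fun u _ v hv => ?_⟩
          rw [if_neg fun h => h2' v hv h.2]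
          simp
        · refine ⟨E ∪ E', 0, fun _ => g (c, c'), hE.union hE', fun u hu v hv => ?_⟩
          have hu' := h2 u fun h => hu (Or.inl h)
          have hv' := h2' v fun h => hv (Or.inr h)
          rw [if_pos ⟨hu'.1, hv'.1⟩, hu'.2, hv'.2, Pi.zero_apply, zero_add]

variable [MeasurableSpace K] [BorelSpace K] (μ : Measure K) [μ.IsAddHaarMeasure]

/-- A linear relation among lifts off the axes is inherited by their integrals; this makes the
integral well-defined whatever the representation. -/
lemma sum_integral_eq_zero {ι : Type*} (s : Finset ι) (c : ι → RatFunc ℂ) (g : ι → K × K → ℂ)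
    (a : ι → F × F) (γ : ι → ℤ × ℤ) (hg : ∀ i, Integrable (g i) (μ.prod μ))
    (h0 : ∀ x y : F, x ≠ 0 → y ≠ 0 →
      ∑ i ∈ s, c i * RatFunc.C (D.lift (g i) (a i) (γ i) (x, y)) = 0) :
    ∑ i ∈ s, c i * (RatFunc.C (∫ u, g i u ∂(μ.prod μ)) *
      RatFunc.X ^ ((γ i).1 + (γ i).2)) = 0 := by
  classical
  let R : Setoid ι := ⟨fun i j => D.SameRect (a i, γ i) (a j, γ j),
    fun _ => D.sameRect_equivalence.refl _, fun h => D.sameRect_equivalence.symm h,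
    fun h h' => D.sameRect_equivalence.trans h h'⟩
  refine Finset.sum_cancels_of_partition_cancels R fun k _ => ?_
  -- Equal products of cosets have equal `γ`, so the power of `X` is common to the class.
  have hfac : ∑ i ∈ s with R i k, c i * (RatFunc.C (∫ u, g i u ∂(μ.prod μ)) *
      RatFunc.X ^ ((γ i).1 + (γ i).2)) =
      (∑ i ∈ s with R i k, (∫ u, g i u ∂(μ.prod μ)) • c i) *
        RatFunc.X ^ ((γ k).1 + (γ k).2) := by
    rw [Finset.sum_mul]
    refine Finset.sum_congr rfl fun i hi => ?_
    have hik : D.SameRect (a i, γ i) (a k, γ k) := (Finset.mem_filter.1 hi).2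
    rw [show (γ i).1 = (γ k).1 from hik.1.1, show (γ i).2 = (γ k).2 from hik.2.1,
      Algebra.smul_def, RatFunc.algebraMap_eq_C]
    ring
  rw [hfac]
  refine mul_eq_zero_of_left ?_ _
  -- Testing against `ℂ`-linear functionals on `ℂ(X)` turns the coefficients into complex scalars,
  -- so that the sum can be moved inside a complex integral.
  rw [← Module.forall_dual_apply_eq_zero_iff ℂ]
  intro l
  rw [map_sum]
  simp only [map_smul, smul_eq_mul]
  have htr (i : ι) (r : K × K) :
      Integrable (fun p : K × K => g i (p + r)) (μ.prod μ) ∧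
        ∫ p, g i (p + r) ∂(μ.prod μ) = ∫ p, g i p ∂(μ.prod μ) :=
    ⟨(hg i).comp_add_right r, integral_add_right_eq_self _ _⟩
  let r (i : ι) : K × K := (D.resExt (D.cosetCoord (a i).1 (γ i).1 (a k).1),
    D.resExt (D.cosetCoord (a i).2 (γ i).2 (a k).2))
  have hsum : ∑ i ∈ s with R i k, (∫ u, g i u ∂(μ.prod μ)) * l (c i) =
      ∫ p, ∑ i ∈ s with R i k, g i (p + r i) * l (c i) ∂(μ.prod μ) := by
    rw [integral_finsetSum _ fun i _ => (htr i (r i)).1.mul_const _]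
    refine Finset.sum_congr rfl fun i _ => ?_
    rw [integral_mul_const, (htr i (r i)).2]
  rw [hsum]
  have hex (i : ι) : ∃ (E : Set K) (h₁ h₂ : K → ℂ), E.Finite ∧ (¬ R i k → ∀ u ∉ E, ∀ v ∉ E,
      D.lift (g i) (a i) (γ i)
        (D.cosetPoint (a k).1 (γ k).1 u, D.cosetPoint (a k).2 (γ k).2 v) = h₁ u + h₂ v) := by
    by_cases hik : R i k
    · exact ⟨∅, 0, 0, Set.finite_empty, fun h => absurd hik h⟩
    · obtain ⟨E, h₁, h₂, hE, h⟩ := D.lift_of_not_sameRect (g i) hik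
      exact ⟨E, h₁, h₂, hE, fun _ => h⟩
  choose E h₁ h₂ hE hlift using hex
  obtain ⟨E₁, hE₁, hne₁⟩ := D.cosetPoint_ne_zero (a k).1 (γ k).1
  obtain ⟨E₂, hE₂, hne₂⟩ := D.cosetPoint_ne_zero (a k).2 (γ k).2
  have hEfin : (E₁ ∪ E₂ ∪ ⋃ i ∈ s, E i).Finite :=
    (hE₁.union hE₂).union (s.finite_toSet.biUnion fun i _ => hE i)
  -- The relation on the product of cosets of `k` expresses the same-class part as minus the
  -- contribution of the other classes, which is a sum of one-variable functions.
  refine integral_prod_eq_zero_of_ae_eq_add (measure_univ_eq_top μ)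
    (h₁ := fun u => -∑ i ∈ s with ¬ R i k, h₁ i u * l (c i))
    (h₂ := fun v => -∑ i ∈ s with ¬ R i k, h₂ i v * l (c i))
    (integrable_finsetSum _ fun i _ => (htr i (r i)).1.mul_const _) ?_
  have hnull : ∀ᵐ u ∂μ, u ∉ E₁ ∪ E₂ ∪ ⋃ i ∈ s, E i :=
    compl_mem_ae_iff.2 (hEfin.measure_zero μ)
  filter_upwards [Measure.quasiMeasurePreserving_fst.ae hnull,
    Measure.quasiMeasurePreserving_snd.ae hnull] with p hu hv
  have hx := hne₁ p.1 fun h => hu (Or.inl (Or.inl h))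
  have hy := hne₂ p.2 fun h => hv (Or.inl (Or.inr h))
  have h5 := congrArg l (h0 _ _ hx hy)
  rw [map_sum, map_zero, ← Finset.sum_filter_add_sum_filter_not s (fun i => R i k)] at h5
  have hl (i : ι) (z : ℂ) : l (c i * RatFunc.C z) = z * l (c i) := by
    rw [mul_comm, ← RatFunc.algebraMap_eq_C, ← Algebra.smul_def, map_smul, smul_eq_mul]
  simp only [hl] at h5
  have h6 : ∑ i ∈ s with R i k, D.lift (g i) (a i) (γ i)
      (D.cosetPoint (a k).1 (γ k).1 p.1, D.cosetPoint (a k).2 (γ k).2 p.2) * l (c i) =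
      ∑ i ∈ s with R i k, g i (p + r i) * l (c i) := by
    refine Finset.sum_congr rfl fun i hi => ?_
    rw [D.lift_of_sameRect (g i) (Finset.mem_filter.1 hi).2]
    rfl
  have h7 : ∑ i ∈ s with ¬ R i k, D.lift (g i) (a i) (γ i)
      (D.cosetPoint (a k).1 (γ k).1 p.1, D.cosetPoint (a k).2 (γ k).2 p.2) * l (c i) =
      ∑ i ∈ s with ¬ R i k, h₁ i p.1 * l (c i) + ∑ i ∈ s with ¬ R i k, h₂ i p.2 * l (c i) := by
    rw [← Finset.sum_add_distrib]
    refine Finset.sum_congr rfl fun i hi => ?_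
    obtain ⟨hs, hik⟩ := Finset.mem_filter.1 hi
    rw [hlift i hik p.1 (fun h => hu (Or.inr (Set.mem_biUnion hs h))) p.2
      (fun h => hv (Or.inr (Set.mem_biUnion hs h))), add_mul]
  rw [h6, h7] at h5
  rw [eq_neg_of_add_eq_zero_left h5, neg_add]

lemma HasIntegral.eq_zero {f : F × F → RatFunc ℂ} {I : RatFunc ℂ} (h : D.HasIntegral μ f I)
    (h0 : ∀ x y : Fˣ, f (x, y) = 0) : I = 0 := by
  rw [HasIntegral, integralGraph, Finsupp.mem_span_iff_linearCombination] at h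
  obtain ⟨c, hc⟩ := h
  choose g a γ hg hz using fun z : {z : (F × F → RatFunc ℂ) × RatFunc ℂ |
    ∃ (g : K × K → ℂ) (a : F × F) (γ : ℤ × ℤ), Integrable g (μ.prod μ) ∧
      z = (fun x => RatFunc.C (D.lift g a γ x),
        RatFunc.C (∫ u, g u ∂(μ.prod μ)) * RatFunc.X ^ (γ.1 + γ.2))} => z.2
  rw [Finsupp.linearCombination_apply, Finsupp.sum] at hc
  have h1 := congrArg Prod.fst hc
  have h2 := congrArg Prod.snd hc
  rw [Prod.fst_sum] at h1
  rw [Prod.snd_sum] at h2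
  dsimp only at h1 h2
  rw [← h2, ← D.sum_integral_eq_zero μ c.support c g a γ hg fun x y hx hy => ?_]
  · refine Finset.sum_congr rfl fun i _ => ?_
    rw [Prod.smul_snd, hz i]
    rfl
  · have h3 := congrFun h1 (x, y)
    rw [Finset.sum_apply] at h3
    have h4 := h0 (Units.mk0 x hx) (Units.mk0 y hy)
    rw [Units.val_mk0, Units.val_mk0, ← h3] at h4
    rw [← h4]
    refine Finset.sum_congr rfl fun i _ => ?_
    rw [Prod.smul_fst, Pi.smul_apply, hz i]
    rfl

/-- Two extensions of the same function can differ only on the axes, so their difference falls under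
`HasIntegral.eq_zero`. -/
theorem HasMulIntegral.unique {φ : Fˣ × Fˣ → RatFunc ℂ} {I J : RatFunc ℂ}
    (hI : D.HasMulIntegral μ φ I) (hJ : D.HasMulIntegral μ φ J) : I = J := by
  obtain ⟨f, hf, hfI⟩ := hI
  obtain ⟨f', hf', hfJ⟩ := hJ
  rw [← sub_eq_zero]
  refine HasIntegral.eq_zero D μ (f := f - f') ((D.integralGraph μ).sub_mem hfI hfJ) fun x y => ?_
  rw [Pi.sub_apply, hf, hf', sub_self]

lemma zeta_eq {f : Fˣ × Fˣ → RatFunc ℂ} {χ : TopK2 F →+ Additive ℂˣ} {s : ℂ} {I : RatFunc ℂ}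
    (h : D.HasZetaIntegral μ f χ s I) : D.zeta μ f χ s = I := by
  have hex : ∃ I, D.HasZetaIntegral μ f χ s I := ⟨I, h⟩
  rw [zeta, dif_pos hex]
  exact HasMulIntegral.unique D μ hex.choose_spec h

lemma existsUnique_hasZetaIntegral {f : Fˣ × Fˣ → RatFunc ℂ} {χ : TopK2 F →+ Additive ℂˣ}
    {s : ℂ} {I : RatFunc ℂ} (h : D.HasZetaIntegral μ f χ s I) :
    ∃! I, D.HasZetaIntegral μ f χ s I :=
  ⟨I, h, fun _ hJ => HasMulIntegral.unique D μ hJ h⟩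

end LocalParams

end Uniqueness

/-! ### Quasi-characters and their unitary normalisation -/

section QuasiCharacter

variable {K : Type*} [Field K] [ValuativeRel K] [TopologicalSpace K]
  [IsNonarchimedeanLocalField K]

lemma isCompact_ord_eq_zero : IsCompact {u : Kˣ | ord (u : K) = 0} := by
  let f : (valuation K).integerˣ →* Kˣ := Units.map ((valuation K).integer.subtype : _ →* K)
  have hf : Continuous f := Continuous.units_map _ continuous_subtype_val
  have : CompactSpace (valuation K).integer :=
    isCompact_iff_compactSpace.1 (IsNonarchimedeanLocalField.isCompact_closedBall K 1)
  have hr : {u : Kˣ | ord (u : K) = 0} = Set.range f := by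
    ext u
    constructor
    · intro hu
      have h1 := (valuation_eq_one_iff u).2 hu
      have h2 := (valuation_eq_one_iff u⁻¹).2 (by rw [ord_inv, show ord (u : K) = 0 from hu]; rfl)
      exact ⟨⟨⟨u, h1.le⟩, ⟨(u⁻¹ : Kˣ), h2.le⟩, by ext; simp, by ext; simp⟩, by ext; rfl⟩
    · rintro ⟨w, rfl⟩
      have h1 := (valuation_le_one_iff (f w)).1 (w : (valuation K).integer).2
      have h2 := (valuation_le_one_iff (f w)⁻¹).1
        (by rw [← map_inv]; exact ((w⁻¹ : (valuation K).integerˣ) : (valuation K).integer).2)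
      rw [ord_inv] at h2
      exact le_antisymm (by omega) h1
  rw [hr]
  exact isCompact_range hf

/-- All powers of `u` stay in the compact unit group, where `ω` is bounded. -/
lemma norm_le_one_of_ord_eq_zero (ω : Kˣ →ₜ* ℂˣ) {u : Kˣ} (hu : ord (u : K) = 0) :
    ‖(ω u : ℂ)‖ ≤ 1 := by
  have hc : Continuous fun x : Kˣ => (ω x : ℂ) :=
    Units.continuous_val.comp ω.continuous_toFun
  obtain ⟨C, hC⟩ := isCompact_ord_eq_zero.exists_bound_of_continuousOn hc.continuousOn
  by_contra! h
  obtain ⟨n, hn⟩ := pow_unbounded_of_one_lt C h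
  have h2 := hC (u ^ n) (by
    have := ord_zpow u n
    rw [hu, mul_zero, zpow_natCast] at this
    exact this)
  rw [map_pow, Units.val_pow_eq_pow_val, norm_pow] at h2
  linarith

lemma norm_eq_one_of_ord_eq_zero (ω : Kˣ →ₜ* ℂˣ) {u : Kˣ} (hu : ord (u : K) = 0) :
    ‖(ω u : ℂ)‖ = 1 := by
  refine le_antisymm (norm_le_one_of_ord_eq_zero ω hu) ?_
  have h := norm_le_one_of_ord_eq_zero ω (u := u⁻¹) (by rw [ord_inv, hu, neg_zero])
  rw [map_inv, Units.val_inv_eq_inv_val, norm_inv] at h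
  exact (inv_le_one₀ (norm_pos_iff.2 (ω u).ne_zero)).1 h

/-- The quasi-character `ω` normalised to take the value `1` at `ϖ`. -/
def normalize (ϖ : Kˣ) (ω : Kˣ →ₜ* ℂˣ) (z : Kˣ) : ℂ := ω (z * (ϖ ^ ord (z : K))⁻¹)

lemma val_eq_normalize_mul (ϖ : Kˣ) (ω : Kˣ →ₜ* ℂˣ) (z : Kˣ) :
    (ω z : ℂ) = normalize ϖ ω z * (ω ϖ : ℂ) ^ ord (z : K) := by
  rw [normalize, map_mul, map_inv, map_zpow, ← Units.val_zpow_eq_zpow_val, ← Units.val_mul,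
    inv_mul_cancel_right]

lemma norm_normalize {ϖ : Kˣ} (hϖ : ord (ϖ : K) = 1) (ω : Kˣ →ₜ* ℂˣ) (z : Kˣ) :
    ‖normalize ϖ ω z‖ = 1 := by
  refine norm_eq_one_of_ord_eq_zero ω ?_
  rw [ord_mul, ord_inv, ord_zpow, hϖ]
  ring

lemma continuous_normalize (ϖ : Kˣ) (ω : Kˣ →ₜ* ℂˣ) : Continuous (normalize ϖ ω) := by
  have h : Continuous fun z : Kˣ => ϖ ^ ord (z : K) :=
    (continuous_of_discreteTopology (f := fun n : ℤ => ϖ ^ n)).comp continuous_ord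
  exact Units.continuous_val.comp (ω.continuous_toFun.comp (continuous_id.mul h.inv))

lemma normalize_unit_mul (ϖ : Kˣ) (ω : Kˣ →ₜ* ℂˣ) {u : Kˣ} (hu : ord (u : K) = 0) (z : Kˣ) :
    normalize ϖ ω (u * z) = ω u * normalize ϖ ω z := by
  rw [normalize, normalize, ord_mul, hu, zero_add, mul_assoc, map_mul, Units.val_mul]

end QuasiCharacter

/-! ### Behaviour of Schwartz–Bruhat functions near zero and infinity -/

section SchwartzBruhat

variable {K : Type*} [Field K] [ValuativeRel K] [TopologicalSpace K]
  [IsNonarchimedeanLocalField K] {g : K → ℂ}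

lemma IsSchwartzBruhat.exists_eq_apply_zero (hg : IsSchwartzBruhat g) :
    ∃ N : ℤ, ∀ z : Kˣ, N ≤ ord (z : K) → g z = g 0 := by
  have hn : {x | g x = g 0} ∈ nhds (0 : K) :=
    (hg.1.isOpen_fiber (g 0)).mem_nhds rfl
  obtain ⟨γ, -, hγ⟩ := (IsValuativeTopology.hasBasis_nhds_zero K).mem_iff.1 hn
  obtain ⟨y, hy⟩ := ValuativeRel.valuation_surjective (γ : ValueGroupWithZero K)
  have hy0 : y ≠ 0 := by
    rintro rfl
    rw [map_zero] at hy
    exact γ.ne_zero hy.symm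
  -- The `+ 1` is needed because the basic neighbourhoods of zero are given by a strict inequality.
  refine ⟨ord y + 1, fun z hz => hγ ?_⟩
  rw [Set.mem_ofPred_eq, ← hy]
  by_contra! h
  have := (valuation_le_iff (Units.mk0 y hy0) z).1 h
  rw [Units.val_mk0] at this
  omega

/-- The open sets `ϖ^(-n) 𝒪` increase to `K`, so one of them contains the compact support. -/
lemma IsSchwartzBruhat.exists_eq_zero (hg : IsSchwartzBruhat g) :
    ∃ m : ℤ, ∀ z : Kˣ, ord (z : K) < m → g z = 0 := by
  obtain ⟨ϖ, hϖ⟩ := exists_ord_eq_one K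
  let U (n : ℕ) : Set K := (fun x => ((ϖ ^ n : Kˣ) : K) * x) ⁻¹' (valuation K).integer
  have hord (n : ℕ) (z : Kˣ) : (z : K) ∈ U n ↔ -(n : ℤ) ≤ ord (z : K) := by
    have h := valuation_le_one_iff (ϖ ^ (n : ℤ) * z)
    rw [ord_mul, ord_zpow, hϖ, Units.val_mul, zpow_natCast] at h
    rw [Set.mem_preimage, SetLike.mem_coe, Valuation.mem_integer_iff, h]
    omega
  have hopen (n : ℕ) : IsOpen (U n) :=
    (Valuation.isOpen_integer (v := valuation K)).preimage (continuous_const_mul _)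
  have hzero (n : ℕ) : (0 : K) ∈ U n := by
    rw [Set.mem_preimage, mul_zero]
    exact zero_mem _
  have hmono : Monotone U := by
    intro a b hab x hx
    by_cases hx0 : x = 0
    · rw [hx0]
      exact hzero b
    · have := (hord a (Units.mk0 x hx0)).1 hx
      exact (hord b (Units.mk0 x hx0)).2 (by omega)
  obtain ⟨n, hn⟩ := hg.2.isCompact.elim_directed_cover U hopen (fun x _ => by
    rw [Set.mem_iUnion]
    by_cases hx0 : x = 0
    · exact ⟨0, by rw [hx0]; exact hzero 0⟩
    · exact ⟨(ord x).natAbs, (hord _ (Units.mk0 x hx0)).2 (by rw [Units.val_mk0]; omega)⟩)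
    hmono.directed_le
  refine ⟨-n, fun z hz => ?_⟩
  by_contra h
  have := (hord n z).1 (hn (subset_tsupport g h))
  omega

end SchwartzBruhat

/-! ### Shells and the tail of the one-dimensional zeta integral -/

section Tail

lemma hasSum_even_zpow_tail {Q : ℂ} (hQ : ‖Q‖ < 1) (hQ0 : Q ≠ 0) (N : ℤ) :
    HasSum (fun n : ℤ => if N ≤ n then Q ^ (2 * n) else 0) (Q ^ (2 * N) / (1 - Q ^ 2)) := by
  have hinj : Function.Injective fun n : ℕ => N + (n : ℤ) := fun a b h => by
    simpa using h
  rw [← hinj.hasSum_iff]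
  · have h2 : ‖Q ^ 2‖ < 1 := by
      rw [norm_pow]
      exact pow_lt_one₀ (norm_nonneg _) hQ two_ne_zero
    have h3 (n : ℕ) : (if N ≤ N + (n : ℤ) then Q ^ (2 * (N + (n : ℤ))) else 0) =
        Q ^ (2 * N) * (Q ^ 2) ^ n := by
      rw [if_pos (by omega), mul_add, zpow_add₀ hQ0, zpow_mul Q 2 n, zpow_natCast]
      rfl
    simp only [Function.comp_def, h3]
    exact (hasSum_geometric_of_norm_lt_one h2).mul_left _
  · intro n hn
    rw [if_neg]
    intro h
    exact hn ⟨(n - N).toNat, by dsimp only; omega⟩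

variable {K : Type*} [Field K] [ValuativeRel K] [TopologicalSpace K]
  [IsNonarchimedeanLocalField K] [MeasurableSpace K] [BorelSpace K]
  (μ : Measure K) [μ.IsAddHaarMeasure]

/-- The restriction of `normalize ϖ ω z * Q ^ (2 ord z)` to `ord z ≥ N`. -/
def tailIntegrand (ϖ : Kˣ) (ω : Kˣ →ₜ* ℂˣ) (Q : ℂ) (N : ℤ) (z : Kˣ) : ℂ :=
  normalize ϖ ω z * if N ≤ ord (z : K) then Q ^ (2 * ord (z : K)) else 0

lemma integrable_tailIntegrand {ϖ : Kˣ} (hϖ : ord (ϖ : K) = 1) (ω : Kˣ →ₜ* ℂˣ) {Q : ℂ}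
    (hQ : ‖Q‖ < 1) (hQ0 : Q ≠ 0) (N : ℤ) :
    Integrable (tailIntegrand ϖ ω Q N) (mulHaar μ) :=
  (integrable_comp_ord μ (hasSum_even_zpow_tail hQ hQ0 N).summable).bdd_mul
    (continuous_normalize ϖ ω).aestronglyMeasurable
    (Filter.Eventually.of_forall fun z => (norm_normalize hϖ ω z).le)

lemma integral_tailIntegrand_of_unramified {ϖ : Kˣ} (hϖ : ord (ϖ : K) = 1) {ω : Kˣ →ₜ* ℂˣ}
    (hω : ∀ u : Kˣ, ord (u : K) = 0 → ω u = 1) {Q : ℂ} (hQ : ‖Q‖ < 1) (hQ0 : Q ≠ 0) (N : ℤ) :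
    ∫ z, tailIntegrand ϖ ω Q N z ∂(mulHaar μ) =
      (mulHaar μ).real {x : Kˣ | ord (x : K) = 0} * (Q ^ (2 * N) / (1 - Q ^ 2)) := by
  have h := hasSum_even_zpow_tail hQ hQ0 N
  rw [← h.tsum_eq, ← integral_comp_ord μ h.summable]
  refine integral_congr_ae (Filter.Eventually.of_forall fun z => ?_)
  have h1 : normalize ϖ ω z = 1 := by
    rw [normalize, hω, Units.val_one]
    rw [ord_mul, ord_inv, ord_zpow, hϖ]
    ring
  simp only [tailIntegrand, h1, one_mul]

/-- Orthogonality: translation by a unit `u` with `ω u ≠ 1` preserves the integral but multiplies it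
by `ω u`. -/
lemma integral_tailIntegrand_of_ramified (ϖ : Kˣ) {ω : Kˣ →ₜ* ℂˣ}
    (hω : ¬ ∀ u : Kˣ, ord (u : K) = 0 → ω u = 1) (Q : ℂ) (N : ℤ) :
    ∫ z, tailIntegrand ϖ ω Q N z ∂(mulHaar μ) = 0 := by
  push Not at hω
  obtain ⟨u, hu, hωu⟩ := hω
  have h := integral_mul_left_eq_self (μ := mulHaar μ) (tailIntegrand ϖ ω Q N) u
  have h2 (z : Kˣ) : tailIntegrand ϖ ω Q N (u * z) = ω u * tailIntegrand ϖ ω Q N z := by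
    rw [tailIntegrand, tailIntegrand, normalize_unit_mul ϖ ω hu, ord_mul, hu, zero_add, mul_assoc]
  simp_rw [h2] at h
  rw [integral_const_mul] at h
  by_contra hne
  exact hωu (Units.ext ((mul_eq_right₀ hne).1 h))

omit [MeasurableSpace K] [BorelSpace K] in
lemma singleIntegrand_eq {ϖ : Kˣ} (g : K → ℂ) (ω : Kˣ →ₜ* ℂˣ) (s : ℂ) (z : Kˣ) :
    singleIntegrand ϖ g ω s z = g z * normalize ϖ ω z *
      ((ω ϖ : ℂ) * (resCard K : ℂ) ^ (-s)) ^ (2 * ord (z : K)) := by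
  rw [singleIntegrand, val_eq_normalize_mul ϖ ω z, mul_zpow, two_mul,
    zpow_add₀ (ω ϖ).ne_zero]
  ring

/-- The part of `g * normalize ϖ ω` supported on `ord z = k`. -/
def shell (ϖ : Kˣ) (g : K → ℂ) (ω : Kˣ →ₜ* ℂˣ) (k : ℤ) : Kˣ → ℂ :=
  {z : Kˣ | ord (z : K) = k}.indicator fun z => g z * normalize ϖ ω z

variable {g : K → ℂ}

lemma IsSchwartzBruhat.integrable_shell (hg : IsSchwartzBruhat g) {ϖ : Kˣ}
    (hϖ : ord (ϖ : K) = 1) (ω : Kˣ →ₜ* ℂˣ) (k : ℤ) :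
    Integrable (shell ϖ g ω k) (mulHaar μ) := by
  obtain ⟨C, hC⟩ := hg.2.exists_bound_of_continuous hg.1.continuous
  rw [shell, integrable_indicator_iff (measurableSet_ord_eq k)]
  refine IntegrableOn.of_bound ?_ ?_ C (Filter.Eventually.of_forall fun z => ?_)
  · rw [mulHaar_ord_eq]
    exact (mulHaar_ord_eq_zero_ne_top μ).lt_top
  · exact ((hg.1.continuous.comp Units.continuous_val).mul
      (continuous_normalize ϖ ω)).aestronglyMeasurable
  · rw [norm_mul, norm_normalize hϖ, mul_one]
    exact hC z

omit [MeasurableSpace K] [BorelSpace K] in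
-- Below order `m` the function `g` vanishes and from order `N` on it equals `g 0`. Only finitely
-- many shells lie between, and on each of them `s` enters through the scalar `Q^(2k)` alone.
lemma singleIntegrand_eq_sum_add_tail {ϖ : Kˣ} (ω : Kˣ →ₜ* ℂˣ) (s : ℂ) {m N : ℤ}
    (hm : ∀ z : Kˣ, ord (z : K) < m → g z = 0) (hN : ∀ z : Kˣ, N ≤ ord (z : K) → g z = g 0)
    (hmN : m ≤ N) (z : Kˣ) :
    singleIntegrand ϖ g ω s z =
      ∑ k ∈ Finset.Ico m N, ((ω ϖ : ℂ) * (resCard K : ℂ) ^ (-s)) ^ (2 * k) * shell ϖ g ω k z +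
      g 0 * tailIntegrand ϖ ω ((ω ϖ : ℂ) * (resCard K : ℂ) ^ (-s)) N z := by
  rw [singleIntegrand_eq, tailIntegrand]
  have hshell (k : ℤ) : shell ϖ g ω k z =
      if ord (z : K) = k then g z * normalize ϖ ω z else 0 := by
    simp [shell, Set.indicator_apply]
  simp only [hshell, mul_ite, mul_zero, Finset.sum_ite_eq, Finset.mem_Ico]
  rcases lt_or_ge (ord (z : K)) m with h1 | h1
  · rw [if_neg (by omega), if_neg (by omega), hm z h1]
    ring
  · rcases lt_or_ge (ord (z : K)) N with h2 | h2
    · rw [if_pos ⟨h1, h2⟩, if_neg (by omega)]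
      ring
    · rw [if_neg (by omega), if_pos h2, hN z h2]
      ring

end Tail

/-! ### The zeta formula and the analytic continuation -/

section Main

variable {F K : Type*} [Field F] [Valued F ℤᵐ⁰] [Field K] [ValuativeRel K] [TopologicalSpace K]
  [IsNonarchimedeanLocalField K] [MeasurableSpace K] [BorelSpace K]
  (μ : Measure K) [μ.IsAddHaarMeasure]

/-- The point is that `m`, `N` and `B` do not depend on `s`, so the finite sum is a fixed Laurent
polynomial in `Q`. -/
lemma integrable_singleIntegrand_and_integral {g : K → ℂ} (hg : IsSchwartzBruhat g) {ϖ : Kˣ}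
    (hϖ : ord (ϖ : K) = 1) (ω : Kˣ →ₜ* ℂˣ) :
    ∃ (m N : ℤ) (B : ℤ → ℂ), ∀ s : ℂ, ‖(ω ϖ : ℂ) * (resCard K : ℂ) ^ (-s)‖ < 1 →
      Integrable (singleIntegrand ϖ g ω s) (mulHaar μ) ∧
      ∫ z, singleIntegrand ϖ g ω s z ∂(mulHaar μ) =
        ∑ k ∈ Finset.Ico m N, ((ω ϖ : ℂ) * (resCard K : ℂ) ^ (-s)) ^ (2 * k) * B k +
        g 0 * ∫ z, tailIntegrand ϖ ω ((ω ϖ : ℂ) * (resCard K : ℂ) ^ (-s)) N z ∂(mulHaar μ) := by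
  obtain ⟨m, hm⟩ := hg.exists_eq_zero
  obtain ⟨N, hN⟩ := hg.exists_eq_apply_zero
  refine ⟨m, max m N, fun k => ∫ z, shell ϖ g ω k z ∂(mulHaar μ), fun s hQ => ?_⟩
  set Q := (ω ϖ : ℂ) * (resCard K : ℂ) ^ (-s)
  have hQ0 : Q ≠ 0 := mul_ne_zero (ω ϖ).ne_zero (resCard_cpow_ne_zero K _)
  have heq := funext (singleIntegrand_eq_sum_add_tail ω s hm
    (fun z hz => hN z ((le_max_right _ _).trans hz)) (le_max_left m N) (ϖ := ϖ))
  have hsh (k : ℤ) := (hg.integrable_shell μ hϖ ω k).const_mul (Q ^ (2 * k))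
  have hsum := integrable_finsetSum (Finset.Ico m (max m N)) fun k _ => hsh k
  have htail := (integrable_tailIntegrand μ hϖ ω hQ hQ0 (max m N)).const_mul (g 0)
  rw [heq]
  refine ⟨hsum.add htail, ?_⟩
  rw [integral_add hsum htail, integral_finsetSum _ fun k _ => hsh k, integral_const_mul]
  simp_rw [integral_const_mul]

namespace LocalParams

variable (D : LocalParams F K)

theorem hasZetaIntegral_compRho {g : K → ℂ} {ω : Kˣ →ₜ* ℂˣ} {s : ℂ}
    (hQ : ‖(ω D.prime : ℂ) * (resCard K : ℂ) ^ (-s)‖ < 1)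
    (h : Integrable (singleIntegrand D.prime g ω s) (mulHaar μ)) :
    D.HasZetaIntegral μ (D.compRho g) (D.pullChar ω) s
      (RatFunc.C ((mulHaar μ).real {x : Kˣ | ord (x : K) = 0} *
        ((1 + (ω D.prime : ℂ) * (resCard K : ℂ) ^ (-s)) /
          (1 - (ω D.prime : ℂ) * (resCard K : ℂ) ^ (-s))) *
        ∫ z, singleIntegrand D.prime g ω s z ∂(mulHaar μ))) := by
  rw [← integral_doubleIntegrand μ D.ord_prime hQ]
  exact D.hasZetaIntegral_of_integrable μ (integrable_doubleIntegrand μ D.ord_prime hQ h)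

theorem zeta_compRho {ω ω₀ : Kˣ →ₜ* ℂˣ} {c s : ℂ} {g : K → ℂ}
    (hω : ∀ x : Kˣ, (ω x : ℂ) = (ω₀ x : ℂ) * (nabs (x : K) : ℂ) ^ c) (hω₀ : ω₀ D.prime = 1)
    (hs : 0 < (s + c).re)
    (hg : Integrable (fun x : Kˣ => g x * (ω x : ℂ) ^ 2 * (nabs (x : K) : ℂ) ^ (2 * s))
      (mulHaar μ)) :
    (∃! I, D.HasZetaIntegral μ (D.compRho g) (D.pullChar ω) s I) ∧
    Integrable (zetaIntegrandK g ω (2 * s + c)) (mulHaar μ) ∧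
    D.zeta μ (D.compRho g) (D.pullChar ω) s =
      RatFunc.C (((mulHaar μ).real {x : Kˣ | ord (x : K) = 0} : ℂ) *
        ((1 + (resCard K : ℂ) ^ (-s - c)) / (1 - (resCard K : ℂ) ^ (-s - c))) *
        zetaK μ g ω (2 * s + c)) := by
  have hq0 : (resCard K : ℂ) ≠ 0 := by
    exact_mod_cast (zero_lt_one.trans (one_lt_resCard K)).ne'
  have hωϖ : (ω D.prime : ℂ) = (resCard K : ℂ) ^ (-c) := by
    rw [hω, hω₀, nabs_cpow, D.ord_prime, zpow_one, Units.val_one, one_mul]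
  have hQ : (ω D.prime : ℂ) * (resCard K : ℂ) ^ (-s) = (resCard K : ℂ) ^ (-s - c) := by
    rw [hωϖ, ← Complex.cpow_add _ _ hq0]
    congr 1
    ring
  have hQ1 : ‖(ω D.prime : ℂ) * (resCard K : ℂ) ^ (-s)‖ < 1 := by
    rw [hQ, Complex.norm_natCast_cpow_of_pos (zero_lt_one.trans (one_lt_resCard K))]
    refine Real.rpow_lt_one_of_one_lt_of_neg (by exact_mod_cast one_lt_resCard K) ?_
    have : (-s - c).re = -(s + c).re := by simp; ring
    rw [this]
    linarith
  have hsingle : singleIntegrand D.prime g ω s = zetaIntegrandK g ω (2 * s + c) := by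
    ext z
    rw [singleIntegrand, zetaIntegrandK, hωϖ, nabs_cpow,
      show -(2 * s + c) = -c + (-s + -s) by ring, Complex.cpow_add _ _ hq0,
      Complex.cpow_add _ _ hq0, mul_zpow, mul_zpow, two_mul,
      zpow_add₀ (resCard_cpow_ne_zero K (-s))]
    ring
  -- Since `ω₀` takes the value `1` at the prime, it has absolute value one everywhere. Dividing `g
  -- ω² |x|^(2s)` by `ω₀` gives `g ω |x|^(2s+c)` without affecting integrability.
  have hint : Integrable (zetaIntegrandK g ω (2 * s + c)) (mulHaar μ) := by
    have hcont : Continuous fun x : Kˣ => ((ω₀ x)⁻¹ : ℂ) :=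
      (Units.continuous_val.comp ω₀.continuous_toFun).inv₀ fun x => (ω₀ x).ne_zero
    refine (hg.bdd_mul (c := 1) hcont.aestronglyMeasurable
      (Filter.Eventually.of_forall fun x => ?_)).congr
      (Filter.Eventually.of_forall fun x => ?_)
    · have h1 := val_eq_normalize_mul D.prime ω₀ x
      rw [hω₀, Units.val_one, one_zpow, mul_one] at h1
      rw [norm_inv, h1, norm_normalize D.ord_prime, inv_one]
    · have h1 : (nabs (x : K) : ℂ) ≠ 0 := by exact_mod_cast (nabs_pos x).ne'
      have h2 : (ω₀ x : ℂ) ≠ 0 := (ω₀ x).ne_zero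
      simp only [zetaIntegrandK]
      rw [Complex.cpow_add _ _ h1, hω]
      field_simp
  have hz := D.hasZetaIntegral_compRho μ hQ1 (hsingle ▸ hint)
  rw [hQ, hsingle] at hz
  exact ⟨D.existsUnique_hasZetaIntegral μ hz, hint, D.zeta_eq μ hz⟩

omit [MeasurableSpace K] [BorelSpace K] in
lemma norm_mul_resCard_cpow_lt_one (w : ℂˣ) {s : ℂ}
    (hs : Real.log ‖(w : ℂ)‖ / Real.log (resCard K) < s.re) :
    ‖(w : ℂ) * (resCard K : ℂ) ^ (-s)‖ < 1 := by
  have hq : (1 : ℝ) < resCard K := by exact_mod_cast one_lt_resCard K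
  have hw : 0 < ‖(w : ℂ)‖ := norm_pos_iff.2 w.ne_zero
  rw [norm_mul, Complex.norm_natCast_cpow_of_pos (zero_lt_one.trans (one_lt_resCard K)),
    Complex.neg_re, Real.rpow_neg (resCard_pos K).le,
    mul_inv_lt_iff₀ (Real.rpow_pos_of_pos (resCard_pos K) _), one_mul,
    ← Real.log_lt_log_iff hw (Real.rpow_pos_of_pos (resCard_pos K) _),
    Real.log_rpow (resCard_pos K)]
  exact (div_lt_iff₀ (Real.log_pos hq)).1 hs

theorem zeta_div_localL {ω : Kˣ →ₜ* ℂˣ} {g : K → ℂ} (hg : IsSchwartzBruhat g) :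
    ∃ σ : ℝ,
      (∀ s : ℂ, σ < s.re →
        ∃! I, D.HasZetaIntegral μ (D.compRho g) (D.pullChar ω) s I) ∧
      ∃ Z : ℂ → ℂ, Differentiable ℂ Z ∧ ∀ s : ℂ, σ < s.re →
        D.zeta μ (D.compRho g) (D.pullChar ω) s /
            RatFunc.C (localL D.prime ω s *
              (1 - (ω D.prime : ℂ) * (resCard K : ℂ) ^ (-s))⁻¹) =
          RatFunc.C (Z s) := by
  obtain ⟨m, N, B, hB⟩ := integrable_singleIntegrand_and_integral μ hg D.ord_prime ω
  set Q : ℂ → ℂ := fun s => (ω D.prime : ℂ) * (resCard K : ℂ) ^ (-s) with hQdef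
  have hQ0 (s : ℂ) : Q s ≠ 0 := mul_ne_zero (ω D.prime).ne_zero (resCard_cpow_ne_zero K _)
  have hQd : Differentiable ℂ Q := fun s => by
    have hq0 : (resCard K : ℂ) ≠ 0 := by
      exact_mod_cast (zero_lt_one.trans (one_lt_resCard K)).ne'
    exact (differentiableAt_id.neg.const_cpow (Or.inl hq0)).const_mul _
  -- `Q` has no zeros, so negative powers are entire as well.
  have hzp (k : ℤ) : Differentiable ℂ fun s => Q s ^ k := fun s =>
    (hQd s).zpow (Or.inl (hQ0 s))
  set S : ℂ → ℂ := fun s => ∑ k ∈ Finset.Ico m N, Q s ^ (2 * k) * B k with hSdef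
  have hSd : Differentiable ℂ S := Differentiable.fun_sum fun k _ => (hzp _).mul_const _
  set V : ℂ := Complex.ofReal ((mulHaar μ).real {x : Kˣ | ord (x : K) = 0})
  have hlt (s : ℂ) (hs : Real.log ‖(ω D.prime : ℂ)‖ / Real.log (resCard K) < s.re) :
      ‖Q s‖ < 1 := norm_mul_resCard_cpow_lt_one (ω D.prime) hs
  have hz (s : ℂ) (hs : Real.log ‖(ω D.prime : ℂ)‖ / Real.log (resCard K) < s.re) :=
    D.hasZetaIntegral_compRho μ (hlt s hs) (hB s (hlt s hs)).1
  refine ⟨Real.log ‖(ω D.prime : ℂ)‖ / Real.log (resCard K),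
    fun s hs => D.existsUnique_hasZetaIntegral μ (hz s hs), ?_⟩
  have hne (s : ℂ) (hs : ‖Q s‖ < 1) : 1 - Q s ≠ 0 ∧ 1 - Q s ^ 2 ≠ 0 := by
    constructor <;> intro h0 <;> rw [sub_eq_zero] at h0
    · rw [← h0] at hs
      simp at hs
    · have := congrArg norm h0
      rw [norm_one, norm_pow] at this
      exact (pow_lt_one₀ (norm_nonneg _) hs two_ne_zero).ne this.symm
  by_cases hω : ∀ u : Kˣ, ord (u : K) = 0 → ω u = 1
  -- Dividing by the `L`-factors multiplies by `(1 - Q)²`, and `(1 - Q)² (1 + Q)/(1 - Q) = 1 - Q²`,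
  -- which is precisely the denominator of the tail.
  · refine ⟨fun s => V * ((1 - Q s ^ 2) * S s + g 0 * (V * Q s ^ (2 * N))),
      ((((differentiable_const _).sub (hQd.pow 2)).mul hSd).add
        (((hzp _).const_mul _).const_mul _)).const_mul _, fun s hs => ?_⟩
    obtain ⟨h1, h2⟩ := hne s (hlt s hs)
    rw [D.zeta_eq μ (hz s hs), (hB s (hlt s hs)).2, localL, if_pos hω,
      integral_tailIntegrand_of_unramified μ D.ord_prime hω (hlt s hs) (hQ0 s), ← map_div₀]
    congr 1
    change V * ((1 + Q s) / (1 - Q s)) * (S s + g 0 * (V * (Q s ^ (2 * N) / (1 - Q s ^ 2)))) /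
      ((1 - Q s)⁻¹ * (1 - Q s)⁻¹) = _
    field_simp
    ring
  -- The tail is zero here, so the only pole to cancel is that of `(1 + Q)/(1 - Q)`, and the single
  -- factor `(1 - Q)⁻¹` in the denominator does so.
  · refine ⟨fun s => V * ((1 + Q s) * S s),
      (((differentiable_const _).add hQd).mul hSd).const_mul _, fun s hs => ?_⟩
    obtain ⟨h1, -⟩ := hne s (hlt s hs)
    rw [D.zeta_eq μ (hz s hs), (hB s (hlt s hs)).2, localL, if_neg hω,
      integral_tailIntegrand_of_ramified μ D.prime hω, ← map_div₀]
    congr 1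
    change V * ((1 + Q s) / (1 - Q s)) * (S s + g 0 * 0) / (1 * (1 - Q s)⁻¹) = _
    field_simp
    ring

end LocalParams

end Main

end TwoDimZeta

end

theorem mainTheorem12 {F K : Type*} [Field F] [Valued F ℤᵐ⁰] [CompleteSpace F]
    [Field K] [ValuativeRel K] [TopologicalSpace K] [IsNonarchimedeanLocalField K]
    [MeasurableSpace K] [BorelSpace K] (μ : Measure K) [μ.IsAddHaarMeasure]
    (D : LocalParams F K) :
    (∀ (ω ω₀ : Kˣ →ₜ* ℂˣ) (c s : ℂ) (g : K → ℂ),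
      (∀ x : Kˣ, (ω x : ℂ) = (ω₀ x : ℂ) * (nabs (x : K) : ℂ) ^ c) → ω₀ D.prime = 1 →
      0 < (s + c).re →
      Integrable (fun x : Kˣ => g x * (ω x : ℂ) ^ 2 * (nabs (x : K) : ℂ) ^ (2 * s))
        (mulHaar μ) →
      (∃! I, D.HasZetaIntegral μ (D.compRho g) (D.pullChar ω) s I) ∧
      Integrable (zetaIntegrandK g ω (2 * s + c)) (mulHaar μ) ∧
      D.zeta μ (D.compRho g) (D.pullChar ω) s =
        RatFunc.C (((mulHaar μ).real {x : Kˣ | ord (x : K) = 0} : ℂ) *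
          ((1 + (resCard K : ℂ) ^ (-s - c)) / (1 - (resCard K : ℂ) ^ (-s - c))) *
          zetaK μ g ω (2 * s + c))) ∧
    (∀ (ω : Kˣ →ₜ* ℂˣ) (g : K → ℂ), IsSchwartzBruhat g →
      ∃ σ : ℝ,
        (∀ s : ℂ, σ < s.re →
          ∃! I, D.HasZetaIntegral μ (D.compRho g) (D.pullChar ω) s I) ∧
        ∃ Z : ℂ → ℂ, Differentiable ℂ Z ∧ ∀ s : ℂ, σ < s.re →
          D.zeta μ (D.compRho g) (D.pullChar ω) s /
              RatFunc.C (localL D.prime ω s *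
                (1 - (ω D.prime : ℂ) * (resCard K : ℂ) ^ (-s))⁻¹) =
            RatFunc.C (Z s)) := by
  exact ⟨fun _ _ _ _ _ hω hω₀ hs hg => D.zeta_compRho μ hω hω₀ hs hg,
    fun _ _ hg => D.zeta_div_localL μ hg⟩
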